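/- Let $m,d\ge 1$ be integers, let $X\subset\mathbb{R}^m$ be a non-empty compact convex set, let $U\subset\mathbb{R}^d$ be a non-empty open set, and for each $j\in\mathbb{N}=\{1,2,\dots\}$ let $I^{(j)}$ be a finite set (with the discrete topology). For each $t\in U$, $j\in\mathbb{N}$ and $i\in I^{(j)}$ let $\phi^{(j)}_{i,t}:X\to X$ be a map. Write $I_n^\infty=\prod_{k\ge n}I^{(k)}$ (with the product topology), $I^\infty=I^\infty_1$, $I^n=\prod_{k=1}^{n}I^{(k)}$; for $\omega=\omega_n\omega_{n+1}\cdots\in I^\infty_n$ write $\omega|_j=\omega_n\cdots\omega_{n+j-1}$; and for a finite word $\omega=\omega_n\cdots\omega_k$ put $\phi_{\omega,t}=\phi^{(n)}_{\omega_n,t}\circ\cdots\circ\phi^{(k)}_{\omega_k,t}$. Suppose that $\{\Phi_t\}_{t\in U}$, $\Phi_t=(\{\phi^{(j)}_{i,t}\}_{i\in I^{(j)}})_{j\ge 1}$, is a transversal family of non-autonomous conformal iterated function systems, that is: 1. (Conformality) There is an open connected set $V\supset X$, independent of $i,j,t$, such that each $\phi^{(j)}_{i,t}$ extends to a $C^1$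 conformal map on $V$ (a $C^1$ diffeomorphism of $V$ onto its image whose derivative at every point is a positive multiple of a linear isometry) with $\phi^{(j)}_{i,t}(V)\subset V$. The extensions are denoted by the same symbols; $|D\phi(x)|$ denotes the scaling factor of the derivative at $x$, and $\|D\phi\|_X=\sup_{x\in X}|D\phi(x)|$. 2. (Uniform contraction) There is $0<\gamma<1$ such that $|D\phi_{\omega|_j,t}(x)|\le\gamma^j$ for all $t\in U$, $n,j\in\mathbb{N}$, $\omega\in I_n^\infty$, $x\in V$. 3. (Bounded distortion) There is a continuous function $K:U\to[1,\infty)$ such that $|D\phi_{\omega|_j,t}(x_1)|\le K(t)\,|D\phi_{\omega|_j,t}(x_2)|$ for all $t\in U$, $n,j\in\mathbb{N}$, $\omega\in I_n^\infty$, $x_1,x_2\in V$. 4. (Distortion continuity) For all $\eta>0$ and $t_0\in U$ there is $\delta>0$ such that for all $t\in U$ with $|t-t_0|\le\delta$, all $n,j\in\mathbb{N}$ and all $\omega\in I_n^\infty$, $$e^{-j\eta}\le \frac{\|D\phi_{\omega|_j,t_0}\|_X}{\|D\phi_{\omega|_j,t}\|_X}\le e^{j\eta}.$$ 5. (Continuity)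 For every $n\in\mathbb{N}$ the map $U\times I_n^\infty\ni(t,\omega)\mapsto\pi_{n,t}(\omega)\in X$ is continuous, where $\pi_{n,t}(\omega)$ is the unique point of $\bigcap_{j\ge1}\phi_{\omega|_j,t}(X)$. 6. (Transversality) For every compact $G\subset U$ there are constants $C_n>0$ $(n\in\mathbb{N})$ with $\lim_{n\to\infty}\frac1n\log C_n=0$ such that for all $n\in\mathbb{N}$, all $\omega,\tau\in I_n^\infty$ with $\omega_n\ne\tau_n$ and all $r>0$, $$\mathcal{L}_d\big(\{t\in G: |\pi_{n,t}(\omega)-\pi_{n,t}(\tau)|\le r\}\big)\le C_n r^m,$$ where $\mathcal{L}_d$ is the $d$-dimensional Lebesgue measure. For $t\in U$ let $J_t=\pi_{1,t}(I^\infty)$ be the limit set. For $s\ge0$ let $$\underline{P}_t(s)=\liminf_{n\to\infty}\frac1n\log\sum_{\omega\in I^n}\|D\phi_{\omega,t}\|_X^{\,s}\in[-\infty,\infty]$$ be the lower pressure, and let $s(t)=\sup\{s\ge0:\underline{P}_t(s)>0\}=\inf\{s\ge0:\underline{P}_t(s)<0\}\in[0,\infty]$ (with $\sup\emptyset=0$,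 $\inf\emptyset=\infty$) be the Bowen dimension. Then: (i) $\dim_H(J_t)=\min\{m,s(t)\}$ for $\mathcal{L}_d$-a.e. $t\in U$, where $\dim_H$ denotes the Hausdorff dimension; (ii) $\mathcal{L}_m(J_t)>0$ for $\mathcal{L}_d$-a.e. $t\in U$ with $s(t)>m$. -/

import Mathlib

open Set Filter Topology MeasureTheory
open scoped NNReal ENNReal

/-- Euclidean space of dimension `m`, with the Euclidean norm and Lebesgue measure. -/
abbrev Euc (m : ℕ) : Type := EuclideanSpace ℝ (Fin m)

namespace NonautonomousIFS

universe u

/-! Levels are numbered from `0`: the index set `I j` is the one usually called `I^{(j+1)}`. -/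

/-- The infinite words `ω_n ω_{n+1} ⋯` that start at level `n`, i.e. the product of the sets `I k`
over `k ≥ n`. For discrete `I k`, it carries the product topology. -/
abbrev InfWord (I : ℕ → Type u) (n : ℕ) : Type u := ∀ k : Set.Ici n, I k

/-- The finite words `ω_n ⋯ ω_{n+j-1}` of length `j` that start at level `n`. -/
abbrev FinWord (I : ℕ → Type u) (n j : ℕ) : Type u := ∀ k : Set.Ico n (n + j), I k

/-- The initial segment `ω|_j` of length `j` of an infinite word. -/
def InfWord.take {I : ℕ → Type u} {n : ℕ} (ω : InfWord I n) (j : ℕ) : FinWord I n j :=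
  fun k => ω ⟨k, k.2.1⟩

/-- The first letter `ω_n` of an infinite word that starts at level `n`. -/
def InfWord.head {I : ℕ → Type u} {n : ℕ} (ω : InfWord I n) : I n := ω ⟨n, le_refl n⟩

/-- Deletion of the last letter of a finite word. -/
def FinWord.init {I : ℕ → Type u} {n j : ℕ} (ω : FinWord I n (j + 1)) : FinWord I n j :=
  fun k => ω ⟨k, k.2.1, k.2.2.trans (Nat.lt_succ_self (n + j))⟩

/-- The last letter `ω_{n+j}` of a word of length `j + 1`. -/
def FinWord.last {I : ℕ → Type u} {n j : ℕ} (ω : FinWord I n (j + 1)) : I (n + j) :=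
  ω ⟨n + j, Nat.le_add_right n j, Nat.lt_succ_self (n + j)⟩

/-- The composition `φ_ω = φ^{(n)}_{ω_n} ∘ ⋯ ∘ φ^{(n+j-1)}_{ω_{n+j-1}}` along a finite word. -/
def wordMap {m : ℕ} {I : ℕ → Type u} (φ : ∀ j, I j → Euc m → Euc m) (n : ℕ) :
    ∀ j : ℕ, FinWord I n j → Euc m → Euc m
  | 0, _ => id
  | j + 1, ω => wordMap φ n j ω.init ∘ φ (n + j) ω.last

/-- `f` is a `C¹` conformal diffeomorphism of the open set `V` onto its image: it is `C¹` and
injective on `V`, and its derivative at each point of `V` is a nonzero multiple of a linear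
isometry (so that the inverse is `C¹` as well). -/
def IsConformalDiffeoOn {m : ℕ} (f : Euc m → Euc m) (V : Set (Euc m)) : Prop :=
  ContDiffOn ℝ 1 f V ∧ InjOn f V ∧ ∀ x ∈ V, IsConformalMap (fderiv ℝ f x)

/-- The scaling factor `|Df(x)|` of a conformal map: the operator norm of its derivative. -/
noncomputable def scaling {m : ℕ} (f : Euc m → Euc m) (x : Euc m) : ℝ := ‖fderiv ℝ f x‖

/-- `‖Df‖_A = sup {|Df(x)| : x ∈ A}`. -/
noncomputable def scalingSup {m : ℕ} (f : Euc m → Euc m) (A : Set (Euc m)) : ℝ :=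
  sSup (scaling f '' A)

/-- The address map: `address X φ n ω` is the point of `⋂_{j ≥ 1} φ_{ω|_j}(X)`. For the systems
considered below this intersection has exactly one point, see
`IsTNCIFS.existsUnique_mem_iInter`. -/
noncomputable def address {m : ℕ} {I : ℕ → Type u} (X : Set (Euc m))
    (φ : ∀ j, I j → Euc m → Euc m) (n : ℕ) (ω : InfWord I n) : Euc m :=
  Classical.epsilon fun x => x ∈ ⋂ j : ℕ, wordMap φ n (j + 1) (ω.take (j + 1)) '' X

/-- The limit set: the image of the address map of the first level. -/
noncomputable def limitSet {m : ℕ} {I : ℕ → Type u} (X : Set (Euc m))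
    (φ : ∀ j, I j → Euc m → Euc m) : Set (Euc m) :=
  Set.range (address X φ 0)

/-- `Z_n(s)`, the sum of `‖Dφ_ω‖_X ^ s` over all words of length `n` that start at the first level
(a finite sum when the index sets are finite). -/
noncomputable def partitionSum {m : ℕ} {I : ℕ → Type u} (X : Set (Euc m))
    (φ : ∀ j, I j → Euc m → Euc m) (n : ℕ) (s : ℝ≥0) : ℝ≥0∞ :=
  ∑' ω : FinWord I 0 n, ENNReal.ofReal (scalingSup (wordMap φ 0 n ω) X) ^ (s : ℝ)

/-- The lower pressure `liminf_n (1/n) log Z_n(s)`, with values in `[-∞, ∞]` and `log 0 = -∞`. -/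
noncomputable def lowerPressure {m : ℕ} {I : ℕ → Type u} (X : Set (Euc m))
    (φ : ∀ j, I j → Euc m → Euc m) (s : ℝ≥0) : EReal :=
  liminf (fun n : ℕ => ENNReal.log (partitionSum X φ n s) / (n : EReal)) atTop

/-- The Bowen dimension `sup {s ≥ 0 : P(s) > 0}` in `[0, ∞]`, with `sup ∅ = 0`. It is also
`inf {s ≥ 0 : P(s) < 0}`, see `IsTNCIFS.bowenDim_eq_iInf`. -/
noncomputable def bowenDim {m : ℕ} {I : ℕ → Type u} (X : Set (Euc m))
    (φ : ∀ j, I j → Euc m → Euc m) : ℝ≥0∞ :=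
  ⨆ (s : ℝ≥0) (_ : 0 < lowerPressure X φ s), (s : ℝ≥0∞)

/-- A transversal family of non-autonomous conformal iterated function systems on `X ⊆ ℝ^m`, with
parameters in `U ⊆ ℝ^d`. The map `φ t j i` restricts to the `i`-th map `X → X` of level `j` at the
parameter `t`, and on `V ⊇ X` it is the conformal extension of this map; its values at
parameters outside `U` and at points outside `V` play no role. -/
structure IsTNCIFS {m d : ℕ} {I : ℕ → Type u} [∀ j, TopologicalSpace (I j)]
    (X V : Set (Euc m)) (U : Set (Euc d)) (φ : Euc d → ∀ j, I j → Euc m → Euc m) : Prop where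
  nonempty_X : X.Nonempty
  isCompact_X : IsCompact X
  convex_X : Convex ℝ X
  nonempty_U : U.Nonempty
  isOpen_U : IsOpen U
  /-- The maps send `X` to `X`. -/
  mapsTo_X : ∀ t ∈ U, ∀ j (i : I j), MapsTo (φ t j i) X X
  isOpen_V : IsOpen V
  isConnected_V : IsConnected V
  X_subset_V : X ⊆ V
  /-- Conformality. -/
  conformal : ∀ t ∈ U, ∀ j (i : I j), IsConformalDiffeoOn (φ t j i) V
  mapsTo_V : ∀ t ∈ U, ∀ j (i : I j), MapsTo (φ t j i) V V
  /-- Uniform contraction. -/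
  uniform_contraction : ∃ γ : ℝ, 0 < γ ∧ γ < 1 ∧
    ∀ t ∈ U, ∀ (n : ℕ) (ω : InfWord I n) (j : ℕ), ∀ x ∈ V,
      scaling (wordMap (φ t) n j (ω.take j)) x ≤ γ ^ j
  /-- Bounded distortion. -/
  bounded_distortion : ∃ K : Euc d → ℝ, ContinuousOn K U ∧ (∀ t ∈ U, 1 ≤ K t) ∧
    ∀ t ∈ U, ∀ (n : ℕ) (ω : InfWord I n) (j : ℕ), ∀ x₁ ∈ V, ∀ x₂ ∈ V,
      scaling (wordMap (φ t) n j (ω.take j)) x₁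
        ≤ K t * scaling (wordMap (φ t) n j (ω.take j)) x₂
  /-- Distortion continuity. -/
  distortion_continuity : ∀ η : ℝ, 0 < η → ∀ t₀ ∈ U, ∃ δ : ℝ, 0 < δ ∧
    ∀ t ∈ U, ‖t - t₀‖ ≤ δ → ∀ (n : ℕ) (ω : InfWord I n) (j : ℕ),
      Real.exp (-(j * η)) ≤ scalingSup (wordMap (φ t₀) n j (ω.take j)) X
          / scalingSup (wordMap (φ t) n j (ω.take j)) X ∧
      scalingSup (wordMap (φ t₀) n j (ω.take j)) X
          / scalingSup (wordMap (φ t) n j (ω.take j)) X ≤ Real.exp (j * η)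
  /-- Joint continuity of the address maps. -/
  address_continuity : ∀ n : ℕ,
    ContinuousOn (fun p : Euc d × InfWord I n => address X (φ p.1) n p.2) (U ×ˢ univ)
  /-- Transversality. -/
  transversality : ∀ G : Set (Euc d), IsCompact G → G ⊆ U → ∃ C : ℕ → ℝ, (∀ n, 0 < C n) ∧
    Tendsto (fun n : ℕ => Real.log (C n) / ((n : ℝ) + 1)) atTop (𝓝 0) ∧
    ∀ (n : ℕ) (ω τ : InfWord I n), ω.head ≠ τ.head → ∀ r : ℝ, 0 < r →
      volume {t ∈ G | ‖address X (φ t) n ω - address X (φ t) n τ‖ ≤ r}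
        ≤ ENNReal.ofReal (C n * r ^ m)

section WellDefined

variable {m d : ℕ} {I : ℕ → Type u} [∀ j, TopologicalSpace (I j)]
  {X V : Set (Euc m)} {U : Set (Euc d)} {φ : Euc d → ∀ j, I j → Euc m → Euc m}

theorem IsTNCIFS.mapsTo_wordMap_X (h : IsTNCIFS X V U φ) {t : Euc d} (ht : t ∈ U) (n : ℕ) :
    ∀ (j : ℕ) (ω : FinWord I n j), MapsTo (wordMap (φ t) n j ω) X X
  | 0, _ => fun _ hx => hx
  | j + 1, ω => (h.mapsTo_wordMap_X ht n j ω.init).comp (h.mapsTo_X t ht (n + j) ω.last)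

theorem IsTNCIFS.contDiffOn_wordMap (h : IsTNCIFS X V U φ) {t : Euc d} (ht : t ∈ U) (n : ℕ) :
    ∀ (j : ℕ) (ω : FinWord I n j), ContDiffOn ℝ 1 (wordMap (φ t) n j ω) V
  | 0, _ => contDiffOn_id
  | j + 1, ω => (h.contDiffOn_wordMap ht n j ω.init).comp
      (h.conformal t ht (n + j) ω.last).1 (h.mapsTo_V t ht (n + j) ω.last)

/-- The address map is well defined. -/
theorem IsTNCIFS.existsUnique_mem_iInter (h : IsTNCIFS X V U φ) {t : Euc d} (ht : t ∈ U) (n : ℕ)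
    (ω : InfWord I n) :
    ∃! x, x ∈ ⋂ j : ℕ, wordMap (φ t) n (j + 1) (ω.take (j + 1)) '' X := by
  have hcont : ∀ j, ContinuousOn (wordMap (φ t) n j (ω.take j)) X := fun j =>
    ((h.contDiffOn_wordMap ht n j (ω.take j)).continuousOn).mono h.X_subset_V
  have hne : (⋂ j : ℕ, wordMap (φ t) n (j + 1) (ω.take (j + 1)) '' X).Nonempty := by
    refine IsCompact.nonempty_iInter_of_sequence_nonempty_isCompact_isClosed _ ?_
      (fun j => h.nonempty_X.image _) (h.isCompact_X.image_of_continuousOn (hcont 1))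
      (fun j => (h.isCompact_X.image_of_continuousOn (hcont (j + 1))).isClosed)
    rintro j _ ⟨x, hx, rfl⟩
    exact ⟨φ t (n + (j + 1)) (ω.take (j + 2)).last x,
      h.mapsTo_X t ht _ _ hx, rfl⟩
  obtain ⟨x, hx⟩ := hne
  refine ⟨x, hx, fun y hy => ?_⟩
  obtain ⟨γ, hγ0, hγ1, hγ⟩ := h.uniform_contraction
  obtain ⟨D, hD⟩ := h.isCompact_X.isBounded.subset_closedBall 0
  have key : ∀ j : ℕ, ‖y - x‖ ≤ γ ^ (j + 1) * (D + D) := by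
    intro j
    obtain ⟨a, ha, rfl⟩ := mem_iInter.1 hx j
    obtain ⟨b, hb, rfl⟩ := mem_iInter.1 hy j
    have h1 := h.convex_X.norm_image_sub_le_of_norm_fderiv_le (𝕜 := ℝ)
      (f := wordMap (φ t) n (j + 1) (ω.take (j + 1))) (C := γ ^ (j + 1))
      (fun z hz => ((h.contDiffOn_wordMap ht n (j + 1) _).contDiffAt
        (h.isOpen_V.mem_nhds (h.X_subset_V hz))).differentiableAt one_ne_zero)
      (fun z hz => hγ t ht n ω (j + 1) z (h.X_subset_V hz)) ha hb
    refine h1.trans (mul_le_mul_of_nonneg_left ?_ (by positivity))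
    have ha' := mem_closedBall_zero_iff.1 (hD ha)
    have hb' := mem_closedBall_zero_iff.1 (hD hb)
    exact (norm_sub_le b a).trans (add_le_add hb' ha')
  have hlim : Tendsto (fun j : ℕ => γ ^ (j + 1) * (D + D)) atTop (𝓝 (0 * (D + D))) :=
    ((tendsto_pow_atTop_nhds_zero_of_lt_one hγ0.le hγ1).comp
      (tendsto_add_atTop_nat 1)).mul_const _
  rw [zero_mul] at hlim
  have := ge_of_tendsto' hlim key
  exact sub_eq_zero.1 (norm_le_zero_iff.1 this)

theorem IsTNCIFS.address_mem (h : IsTNCIFS X V U φ) {t : Euc d} (ht : t ∈ U) (n : ℕ)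
    (ω : InfWord I n) :
    address X (φ t) n ω ∈ ⋂ j : ℕ, wordMap (φ t) n (j + 1) (ω.take (j + 1)) '' X :=
  Classical.epsilon_spec (h.existsUnique_mem_iInter ht n ω).exists

/-- Every finite word extends to an infinite one if there are infinite words at all. -/
theorem FinWord.exists_take_eq {I : ℕ → Type u} {n j : ℕ} (ω₀ : InfWord I n) (ω : FinWord I n j) :
    ∃ τ : InfWord I n, τ.take j = ω := by
  classical
  refine ⟨fun k => if hk : (k : ℕ) < n + j then ω ⟨k, k.2, hk⟩ else ω₀ k, ?_⟩
  funext k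
  exact dif_pos k.2.2

theorem IsTNCIFS.exists_partitionSum_le (h : IsTNCIFS X V U φ) {t : Euc d} (ht : t ∈ U)
    (ω₀ : InfWord I 0) :
    ∃ γ : ℝ, 0 < γ ∧ γ < 1 ∧ ∀ (n : ℕ) (a c : ℝ≥0),
      partitionSum X (φ t) n (a + c)
        ≤ ENNReal.ofReal (Real.exp (n * (c * Real.log γ))) * partitionSum X (φ t) n a := by
  obtain ⟨γ, hγ0, hγ1, hγ⟩ := h.uniform_contraction
  refine ⟨γ, hγ0, hγ1, fun n a c => ?_⟩
  unfold partitionSum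
  rw [← ENNReal.tsum_mul_left]
  refine ENNReal.tsum_le_tsum fun ω => ?_
  obtain ⟨τ, rfl⟩ := FinWord.exists_take_eq ω₀ ω
  have hle : scalingSup (wordMap (φ t) 0 n (τ.take n)) X ≤ γ ^ n := by
    refine csSup_le (h.nonempty_X.image _) ?_
    rintro _ ⟨x, hx, rfl⟩
    exact hγ t ht 0 τ n x (h.X_subset_V hx)
  have hexp : ENNReal.ofReal (Real.exp (n * (c * Real.log γ)))
      = ENNReal.ofReal (γ ^ n) ^ (c : ℝ) := by
    rw [ENNReal.ofReal_rpow_of_pos (by positivity), Real.rpow_def_of_pos (by positivity),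
      Real.log_pow]
    congr 2
    ring
  rw [NNReal.coe_add, ENNReal.rpow_add_of_nonneg (a : ℝ) (c : ℝ) a.2 c.2, hexp, mul_comm]
  gcongr

/-- The supremum and the infimum that may serve to define the Bowen dimension agree. -/
theorem IsTNCIFS.bowenDim_eq_iInf (h : IsTNCIFS X V U φ) {t : Euc d} (ht : t ∈ U) :
    bowenDim X (φ t) = ⨅ (s : ℝ≥0) (_ : lowerPressure X (φ t) s < 0), (s : ℝ≥0∞) := by
  rcases isEmpty_or_nonempty (InfWord I 0) with hI | ⟨⟨ω₀⟩⟩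
  · obtain ⟨k, hk⟩ : ∃ k : Set.Ici 0, IsEmpty (I k) := by
      by_contra! hcon
      exact hI.false fun k => (hcon k).some
    have hP : ∀ s, lowerPressure X (φ t) s = ⊥ := by
      intro s
      have : (fun n : ℕ => ENNReal.log (partitionSum X (φ t) n s) / (n : EReal))
          =ᶠ[atTop] fun _ => ⊥ := by
        filter_upwards [eventually_gt_atTop (k : ℕ)] with n hn
        have : IsEmpty (FinWord I 0 n) := ⟨fun ω => hk.false (ω ⟨k, k.2, by omega⟩)⟩
        have hz : partitionSum X (φ t) n s = 0 := by simp [partitionSum]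
        rw [hz, ENNReal.log_zero]
        exact EReal.bot_div_of_pos_ne_top (by exact_mod_cast (Nat.zero_le _).trans_lt hn)
          (EReal.natCast_ne_top n)
      rw [lowerPressure, liminf_congr this, liminf_const]
    refine le_antisymm (by simp [bowenDim, hP]) ?_
    exact (iInf₂_le (0 : ℝ≥0) (by rw [hP]; exact EReal.bot_lt_zero)).trans (by simp)
  obtain ⟨γ, hγ0, hγ1, hZ⟩ := h.exists_partitionSum_le ht ω₀
  have hlog : Real.log γ < 0 := Real.log_neg hγ0 hγ1
  have hstep : ∀ (a c : ℝ≥0) (n : ℕ), 0 < n →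
      ENNReal.log (partitionSum X (φ t) n (a + c)) / (n : EReal)
        ≤ ((c * Real.log γ : ℝ) : EReal)
          + ENNReal.log (partitionSum X (φ t) n a) / (n : EReal) := by
    intro a c n hn
    have hn' : (0 : EReal) < n := by exact_mod_cast hn
    have h1 := ENNReal.log_le_log (hZ n a c)
    rw [ENNReal.log_mul_add, ENNReal.log_ofReal_of_pos (Real.exp_pos _), Real.log_exp] at h1
    refine (EReal.monotone_div_right_of_nonneg hn'.le h1).trans (le_of_eq ?_)
    show (_ + _) / (n : EReal) = _
    rw [EReal.div_eq_inv_mul, EReal.div_eq_inv_mul, EReal.left_distrib_of_nonneg_of_ne_top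
      (EReal.inv_nonneg_of_nonneg hn'.le) (EReal.inv_lt_top _).ne]
    congr 1
    rw [← EReal.div_eq_inv_mul, ← EReal.coe_natCast, ← EReal.coe_div]
    congr 1
    have : (n : ℝ) ≠ 0 := by positivity
    field_simp
  have hstrict : ∀ a b : ℝ≥0, a < b → lowerPressure X (φ t) a ≤ 0 →
      lowerPressure X (φ t) b < 0 := by
    intro a b hab ha
    obtain ⟨c, rfl⟩ := exists_add_of_le hab.le
    have hc : (0 : ℝ) < c := by exact_mod_cast (lt_add_iff_pos_right a).1 hab
    have hneg : (c : ℝ) * Real.log γ < 0 := mul_neg_of_pos_of_neg hc hlog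
    have hfr : ∃ᶠ n : ℕ in atTop, ENNReal.log (partitionSum X (φ t) n a) / (n : EReal)
        < ((-(c * Real.log γ / 2) : ℝ) : EReal) := by
      refine frequently_lt_of_liminf_lt (by isBoundedDefault) (ha.trans_lt ?_)
      exact_mod_cast (by linarith : (0 : ℝ) < -(c * Real.log γ / 2))
    refine (liminf_le_of_frequently_le' (x := ((c * Real.log γ / 2 : ℝ) : EReal)) ?_).trans_lt
      (by exact_mod_cast (by linarith : c * Real.log γ / 2 < 0))
    refine (hfr.and_eventually (eventually_gt_atTop 0)).mono fun n hn => ?_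
    refine (hstep a c n hn.2).trans ((add_le_add_right hn.1.le _).trans (le_of_eq ?_))
    rw [← EReal.coe_add]
    congr 1
    ring
  refine le_antisymm (iSup₂_le fun a ha => le_iInf₂ fun b hb => ?_) ?_
  · by_contra! hlt
    exact (hstrict b a (by exact_mod_cast hlt) hb.le).not_gt ha
  · by_contra! hlt
    obtain ⟨a, ha1, ha2⟩ := ENNReal.lt_iff_exists_nnreal_btwn.1 hlt
    obtain ⟨b, hb1, hb2⟩ := ENNReal.lt_iff_exists_nnreal_btwn.1 ha2
    have hPa : lowerPressure X (φ t) a ≤ 0 := by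
      by_contra! hpos
      exact ha1.not_ge (le_iSup₂ (f := fun (s : ℝ≥0) (_ : 0 < lowerPressure X (φ t) s) =>
        (s : ℝ≥0∞)) a hpos)
    exact hb2.not_ge (iInf₂_le b (hstrict a b (by exact_mod_cast hb1) hPa))

end WellDefined

end NonautonomousIFS

namespace NonautonomousIFS

universe u

section Frostman

variable {E : Type*} [MetricSpace E] [MeasurableSpace E] [BorelSpace E]

theorem measurableSet_dist_le [SecondCountableTopology E] (r : ℝ) :
    MeasurableSet {p : E × E | dist p.1 p.2 ≤ r} :=
  (isClosed_le continuous_dist continuous_const).measurableSet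

theorem preimage_mk_dist_le {E : Type*} [MetricSpace E] (x : E) (r : ℝ) :
    Prod.mk x ⁻¹' {p : E × E | dist p.1 p.2 ≤ r} = Metric.closedBall x r := by
  ext y
  simp [dist_comm]

theorem measurable_measure_closedBall [SecondCountableTopology E] (ν : Measure E) [SFinite ν]
    (r : ℝ) :
    Measurable fun x => ν (Metric.closedBall x r) := by
  simpa only [preimage_mk_dist_le] using
    measurable_measure_prodMk_left (ν := ν) (measurableSet_dist_le (E := E) r)

theorem lintegral_measure_closedBall [SecondCountableTopology E] (ν : Measure E) [SFinite ν] (r : ℝ) :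
    ∫⁻ x, ν (Metric.closedBall x r) ∂ν = (ν.prod ν) {p | dist p.1 p.2 ≤ r} := by
  rw [Measure.prod_apply (measurableSet_dist_le r)]
  simp only [preimage_mk_dist_le]

theorem lintegral_measure_closedBall_div [SecondCountableTopology E] (ν : Measure E) [SFinite ν]
    (r : ℝ) (c : ℝ≥0∞) :
    ∫⁻ x, ν (Metric.closedBall x r) / c ∂ν = (ν.prod ν) {p | dist p.1 p.2 ≤ r} / c := by
  simp only [div_eq_mul_inv]
  rw [lintegral_mul_const _ (measurable_measure_closedBall ν _), lintegral_measure_closedBall]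

/-- Mass distribution principle: a measure whose balls of radius `2⁻ⁿ` around the points of a set
of positive measure have mass at most a constant times `2^{-ns}` is carried by sets of dimension
at least `s`. -/
theorem le_dimH_of_measure_closedBall_le (ν : Measure E) [IsFiniteMeasure ν] {S A : Set E}
    (hS : ν Sᶜ = 0) (hA : MeasurableSet A) (hνA : ν A ≠ 0) {s : ℝ≥0} (hs : 0 < s) {M : ℝ≥0∞}
    (hM : M ≠ ∞) (h : ∀ x ∈ A, ∀ n : ℕ, ν (Metric.closedBall x ((1 / 2 : ℝ) ^ n))
      ≤ M * ENNReal.ofReal ((1 / 2 : ℝ) ^ n) ^ (s : ℝ)) :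
    (s : ℝ≥0∞) ≤ dimH S := by
  have hs' : (0 : ℝ) < s := by exact_mod_cast hs
  set c : ℝ≥0∞ := (M + 1) * 2 ^ (s : ℝ) with hc
  have hc0 : c ≠ 0 := by simp [hc]
  have hct : c ≠ ∞ := ENNReal.mul_ne_top (by simp [hM]) (by simp)
  have key : ∀ u : Set E, Metric.ediam u ≤ 1 →
      (c⁻¹ • ν.restrict A) u ≤ Metric.ediam u ^ (s : ℝ) := by
    intro u hu
    rw [Measure.smul_apply, smul_eq_mul, Measure.restrict_apply' hA, mul_comm,
      ← div_eq_mul_inv]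
    refine ENNReal.div_le_of_le_mul' ?_
    rcases (u ∩ A).eq_empty_or_nonempty with he | ⟨x, hxu, hxA⟩
    · simp [he]
    have hut : Metric.ediam u ≠ ∞ := (hu.trans_lt ENNReal.one_lt_top).ne
    have hbdd : Bornology.IsBounded u := Metric.isBounded_iff_ediam_ne_top.2 hut
    have hsub : u ∩ A ⊆ Metric.closedBall x (Metric.diam u) := fun y hy =>
      Metric.dist_le_diam_of_mem hbdd hy.1 hxu
    have hd1 : Metric.diam u ≤ 1 := ENNReal.toReal_le_of_le_ofReal zero_le_one (by simpa using hu)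
    rcases (Metric.diam_nonneg (s := u)).eq_or_lt with hd | hd
    · have h0 : ν (u ∩ A) ≤ 0 := by
        have hlim : Tendsto (fun n : ℕ => M * ENNReal.ofReal ((1 / 2 : ℝ) ^ n) ^ (s : ℝ)) atTop
            (𝓝 (M * ENNReal.ofReal 0 ^ (s : ℝ))) := by
          refine ENNReal.Tendsto.const_mul (((ENNReal.continuous_rpow_const).tendsto _).comp
            (ENNReal.tendsto_ofReal
              (tendsto_pow_atTop_nhds_zero_of_lt_one (by norm_num) (by norm_num)))) (Or.inr hM)
        rw [ENNReal.ofReal_zero, ENNReal.zero_rpow_of_pos hs', mul_zero] at hlim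
        refine ge_of_tendsto' hlim fun n => (measure_mono (hsub.trans ?_)).trans (h x hxA n)
        exact Metric.closedBall_subset_closedBall (by rw [← hd]; positivity)
      exact h0.trans (by simp)
    · obtain ⟨n, hn1, hn2⟩ := exists_nat_pow_near_of_lt_one hd hd1
        (by norm_num : (0 : ℝ) < 1 / 2) (by norm_num)
      have hdu : ENNReal.ofReal (Metric.diam u) = Metric.ediam u := ENNReal.ofReal_toReal hut
      calc ν (u ∩ A) ≤ ν (Metric.closedBall x ((1 / 2 : ℝ) ^ n)) :=
            measure_mono (hsub.trans (Metric.closedBall_subset_closedBall hn2))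
        _ ≤ M * ENNReal.ofReal ((1 / 2 : ℝ) ^ n) ^ (s : ℝ) := h x hxA n
        _ ≤ (M + 1) * (2 * Metric.ediam u) ^ (s : ℝ) := by
            gcongr
            · exact le_self_add
            · rw [← hdu, ← ENNReal.ofReal_ofNat 2, ← ENNReal.ofReal_mul (by norm_num)]
              refine ENNReal.ofReal_le_ofReal ?_
              rw [pow_succ] at hn1
              linarith
        _ = c * Metric.ediam u ^ (s : ℝ) := by
            rw [ENNReal.mul_rpow_of_nonneg _ _ hs'.le, hc, mul_assoc]
  have hle := Measure.le_hausdorffMeasure (s : ℝ) _ 1 one_pos key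
  refine le_dimH_of_hausdorffMeasure_ne_zero fun h0 => ?_
  have h1 : (c⁻¹ • ν.restrict A) S = 0 := le_antisymm ((hle S).trans h0.le) zero_le
  rw [Measure.smul_apply, smul_eq_mul, Measure.restrict_apply' hA, mul_eq_zero] at h1
  rcases h1 with h1 | h1
  · exact hct (ENNReal.inv_eq_zero.1 h1)
  · refine hνA (le_antisymm ?_ zero_le)
    calc ν A ≤ ν (S ∩ A) + ν Sᶜ := by
          refine (measure_mono fun x hx => ?_).trans (measure_union_le _ _)
          by_cases hxS : x ∈ S
          · exact Or.inl ⟨hxS, hx⟩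
          · exact Or.inr hxS
      _ = 0 := by rw [h1, hS, add_zero]

/-- A measure with finite (discretized) `s`-energy is carried by sets of dimension at least `s`. -/
theorem le_dimH_of_tsum_ne_top [SecondCountableTopology E] (ν : Measure E) [IsFiniteMeasure ν]
    (hν : ν ≠ 0) {S : Set E} (hS : ν Sᶜ = 0) {s : ℝ≥0} (hs : 0 < s)
    (h : ∑' n : ℕ, (ν.prod ν) {p | dist p.1 p.2 ≤ (1 / 2 : ℝ) ^ n}
      / ENNReal.ofReal ((1 / 2 : ℝ) ^ n) ^ (s : ℝ) ≠ ∞) :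
    (s : ℝ≥0∞) ≤ dimH S := by
  set g : E → ℝ≥0∞ := fun x => ∑' n : ℕ, ν (Metric.closedBall x ((1 / 2 : ℝ) ^ n))
      / ENNReal.ofReal ((1 / 2 : ℝ) ^ n) ^ (s : ℝ) with hg
  have hgm : Measurable g :=
    Measurable.tsum fun n => (measurable_measure_closedBall ν _).div_const _
  have hgi : ∫⁻ x, g x ∂ν ≠ ∞ := by
    rw [hg, lintegral_tsum fun n => ((measurable_measure_closedBall ν _).div_const _).aemeasurable]
    simpa only [lintegral_measure_closedBall_div] using h
  have hfin : ∀ᵐ x ∂ν, g x < ∞ := ae_lt_top hgm hgi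
  obtain ⟨M, hM⟩ : ∃ M : ℕ, ν {x | g x ≤ M} ≠ 0 := by
    by_contra! hcon
    refine hν (Measure.measure_univ_eq_zero.1 (le_antisymm ?_ zero_le))
    have h1 : ν (⋃ M : ℕ, {x | g x ≤ M}) = 0 := measure_iUnion_null hcon
    rw [← h1]
    refine measure_mono_ae ?_
    filter_upwards [hfin] with x hx _
    obtain ⟨M, hM⟩ := ENNReal.exists_nat_gt hx.ne
    exact mem_iUnion.2 ⟨M, hM.le⟩
  refine le_dimH_of_measure_closedBall_le ν hS (measurableSet_le hgm measurable_const) hM hs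
    (ENNReal.natCast_ne_top M) fun x hx n => ?_
  have hx' : g x ≤ M := hx
  have hpos : ENNReal.ofReal ((1 / 2 : ℝ) ^ n) ^ (s : ℝ) ≠ 0 := by
    rw [Ne, ENNReal.rpow_eq_zero_iff_of_pos (by exact_mod_cast hs)]
    simp only [ENNReal.ofReal_eq_zero, not_le]
    positivity
  have htop : ENNReal.ofReal ((1 / 2 : ℝ) ^ n) ^ (s : ℝ) ≠ ∞ :=
    ENNReal.rpow_ne_top_of_nonneg s.2 ENNReal.ofReal_ne_top
  rw [← ENNReal.div_le_iff hpos htop]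
  exact (ENNReal.le_tsum n).trans hx'

end Frostman

/-- A finite measure on `ℝ^m` with finite lower density at almost all points is carried by sets of
positive Lebesgue measure. -/
theorem volume_pos_of_liminf_ne_top {m : ℕ} (ν : Measure (Euc m)) [IsFiniteMeasure ν]
    (hν : ν ≠ 0) {S : Set (Euc m)} (hS : ν Sᶜ = 0)
    (h : liminf (fun n : ℕ => (ν.prod ν) {p | dist p.1 p.2 ≤ (1 / 2 : ℝ) ^ n}
      / ENNReal.ofReal ((1 / 2 : ℝ) ^ n) ^ (m : ℝ)) atTop ≠ ∞) :
    0 < volume S := by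
  set δ : ℕ → ℝ≥0∞ := fun n => ENNReal.ofReal ((1 / 2 : ℝ) ^ n) ^ (m : ℝ) with hδ
  have hgi : ∫⁻ x, liminf (fun n : ℕ => ν (Metric.closedBall x ((1 / 2 : ℝ) ^ n)) / δ n) atTop ∂ν
      ≠ ∞ := by
    refine ne_top_of_le_ne_top h ((lintegral_liminf_le fun n =>
      (measurable_measure_closedBall ν _).div_const _).trans (le_of_eq ?_))
    simp only [lintegral_measure_closedBall_div]
    rfl
  have hfin := ae_lt_top (Measurable.liminf fun n =>
      (measurable_measure_closedBall ν ((1 / 2 : ℝ) ^ n)).div_const (δ n)) hgi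
  have hrn := Besicovitch.ae_tendsto_rnDeriv (volume : Measure (Euc m)) ν
  have hpos : ∀ᵐ x ∂ν, (volume : Measure (Euc m)).rnDeriv ν x ≠ 0 := by
    filter_upwards [hfin, hrn] with x hx hx' h0
    rw [h0] at hx'
    set b : ℝ≥0∞ := volume (Metric.ball (0 : Euc m) 1) with hb
    have hb0 : b ≠ 0 := (Metric.measure_ball_pos _ _ one_pos).ne'
    have hr : Tendsto (fun n : ℕ => ((1 / 2 : ℝ) ^ n)) atTop (𝓝[>] 0) :=
      tendsto_nhdsWithin_iff.2 ⟨tendsto_pow_atTop_nhds_zero_of_lt_one (by norm_num) (by norm_num),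
        Eventually.of_forall fun n => by simp⟩
    have h1 := hx'.comp hr
    have h2 : ∀ n : ℕ, volume (Metric.closedBall x ((1 / 2 : ℝ) ^ n)) = δ n * b := by
      intro n
      rw [Measure.addHaar_closedBall _ _ (by positivity), hδ, hb, finrank_euclideanSpace_fin,
        ENNReal.ofReal_pow (by positivity)]
      simp only [ENNReal.rpow_natCast]
    have hδ0 : ∀ n, δ n ≠ 0 := fun n => by
      simp only [hδ, ENNReal.rpow_natCast]
      refine pow_ne_zero _ ?_
      simp only [Ne, ENNReal.ofReal_eq_zero, not_le]
      positivity
    have hδt : ∀ n, δ n ≠ ∞ := fun n =>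
      ENNReal.rpow_ne_top_of_nonneg (Nat.cast_nonneg _) ENNReal.ofReal_ne_top
    obtain ⟨M, hM1, hM2⟩ := ENNReal.lt_iff_exists_nnreal_btwn.1 hx
    have hfr := frequently_lt_of_liminf_lt (by isBoundedDefault) hM1
    have hM0 : M ≠ 0 := by
      rintro rfl
      simp at hM1
    have hev := h1.eventually (gt_mem_nhds (show (0 : ℝ≥0∞) < b / M from
      ENNReal.div_pos hb0 ENNReal.coe_ne_top))
    obtain ⟨n, hn1, hn2⟩ := (hfr.and_eventually hev).exists
    simp only [Function.comp_apply, h2] at hn2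
    have h3 : ν (Metric.closedBall x ((1 / 2 : ℝ) ^ n)) < M * δ n :=
      (ENNReal.div_lt_iff (Or.inl (hδ0 n)) (Or.inl (hδt n))).1 hn1
    have h4 : b / M ≤ δ n * b / ν (Metric.closedBall x ((1 / 2 : ℝ) ^ n)) := by
      calc b / M = δ n * b / (M * δ n) := by
            rw [mul_comm (δ n) b, ENNReal.mul_div_mul_right _ _ (hδ0 n) (hδt n)]
        _ ≤ _ := by gcongr
    exact absurd hn2 h4.not_gt
  refine pos_iff_ne_zero.2 fun h0 => hν ?_
  set T := toMeasurable volume S with hT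
  have hT0 : volume T = 0 := by rw [hT, measure_toMeasurable, h0]
  have hTm : MeasurableSet T := measurableSet_toMeasurable _ _
  have h5 : ∫⁻ x in T, (volume : Measure (Euc m)).rnDeriv ν x ∂ν = 0 :=
    le_antisymm ((Measure.setLIntegral_rnDeriv_le T).trans hT0.le) zero_le
  rw [lintegral_eq_zero_iff (Measure.measurable_rnDeriv _ _)] at h5
  have h6 : ν T = 0 := by
    rw [← Measure.restrict_eq_zero, ← ae_eq_bot, ← Filter.empty_mem_iff_bot]
    filter_upwards [h5, ae_restrict_of_ae hpos] with x hx1 hx2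
    exact hx2 hx1
  refine Measure.measure_univ_eq_zero.1 (le_antisymm ?_ zero_le)
  calc ν univ ≤ ν T + ν Sᶜ := by
        refine (measure_mono fun x _ => ?_).trans (measure_union_le _ _)
        by_cases hxS : x ∈ S
        · exact Or.inl (subset_toMeasurable _ _ hxS)
        · exact Or.inr hxS
    _ = 0 := by rw [h6, hS, add_zero]

section InverseLipschitz

variable {E : Type*} [NormedAddCommGroup E] [NormedSpace ℝ E] [FiniteDimensional ℝ E]

/-- If `f` is an injective local diffeomorphism on an open set whose inverse derivatives are bounded
by `L`, then `f` expands distances to the centre of a closed ball in that set by at least `L⁻¹`,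
up to saturation at the radius of the ball. -/
theorem min_norm_sub_le_mul_norm_image_sub {f : E → E} {f' : E → E ≃L[ℝ] E} {V : Set E}
    (hV : IsOpen V) (hinj : InjOn f V)
    (hf : ∀ z ∈ V, HasStrictFDerivAt f (f' z : E →L[ℝ] E) z) {L : ℝ}
    (hL : ∀ z ∈ V, ‖((f' z).symm : E →L[ℝ] E)‖ ≤ L) {x : E} {r : ℝ}
    (hr : 0 < r) (hx : Metric.closedBall x r ⊆ V) {y : E} (hy : y ∈ V) :
    min ‖y - x‖ r ≤ L * ‖f y - f x‖ := by
  by_contra! hlt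
  have hxV : x ∈ V := hx (Metric.mem_closedBall_self hr.le)
  have hL0 : 0 ≤ L := (norm_nonneg _).trans (hL x hxV)
  obtain ⟨R, hR1, hR2⟩ := exists_between hlt
  have hR0 : 0 < R := (mul_nonneg hL0 (norm_nonneg _)).trans_lt hR1
  have hRy : R < ‖y - x‖ := hR2.trans_le (min_le_left _ _)
  have hRV : Metric.closedBall x R ⊆ V :=
    (Metric.closedBall_subset_closedBall (hR2.le.trans (min_le_right _ _))).trans hx
  have hcont : ContinuousOn f V := fun z hz => (hf z hz).continuousAt.continuousWithinAt
  have hopen : ∀ z ∈ V, ∀ N ∈ 𝓝 z, f '' N ∈ 𝓝 (f z) := fun z hz N hN => by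
    rw [← (hf z hz).map_nhds_eq_of_equiv]
    exact image_mem_map hN
  have hsphere : (Metric.sphere x R).Nonempty := by
    refine ⟨x + (R / ‖y - x‖) • (y - x), ?_⟩
    have h0 : ‖y - x‖ ≠ 0 := (hR0.trans hRy).ne'
    rw [mem_sphere_iff_norm, add_sub_cancel_left, norm_smul, Real.norm_of_nonneg (by positivity),
      div_mul_cancel₀ _ h0]
  obtain ⟨z₀, hz₀, hmin⟩ := (isCompact_sphere x R).exists_isMinOn hsphere
    (f := fun z => ‖f z - f x‖)
    ((hcont.mono (Metric.sphere_subset_closedBall.trans hRV)).sub continuousOn_const).norm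
  set ρ := ‖f z₀ - f x‖ with hρ
  have hz₀V : z₀ ∈ V := hRV (Metric.sphere_subset_closedBall hz₀)
  have hz₀x : ‖z₀ - x‖ = R := mem_sphere_iff_norm.1 hz₀
  have hρ0 : 0 < ρ := by
    rw [hρ, norm_pos_iff, sub_ne_zero]
    intro h
    rw [hinj hz₀V hxV h, sub_self, norm_zero] at hz₀x
    exact hR0.ne hz₀x
  have hball : Metric.ball (f x) ρ ⊆ f '' Metric.ball x R := by
    refine (convex_ball _ _).isPreconnected.subset_of_closure_inter_subset ?_
      ⟨f x, Metric.mem_ball_self hρ0, mem_image_of_mem f (Metric.mem_ball_self hR0)⟩ ?_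
    · rw [isOpen_iff_mem_nhds]
      rintro _ ⟨z, hz, rfl⟩
      exact hopen z (hRV (Metric.ball_subset_closedBall hz)) _ (Metric.isOpen_ball.mem_nhds hz)
    · rintro p ⟨hp, hpB⟩
      have hcl : IsClosed (f '' Metric.closedBall x R) :=
        ((isCompact_closedBall x R).image_of_continuousOn (hcont.mono hRV)).isClosed
      obtain ⟨z, hz, rfl⟩ :=
        closure_minimal (image_mono Metric.ball_subset_closedBall) hcl hp
      refine mem_image_of_mem f (mem_ball_iff_norm.2
        ((mem_closedBall_iff_norm.1 hz).lt_of_ne fun h => ?_))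
      have h1 : ρ ≤ ‖f z - f x‖ := hmin (mem_sphere_iff_norm.2 h)
      exact h1.not_gt (mem_ball_iff_norm.1 hpB)
  have hρy : ρ ≤ ‖f y - f x‖ := by
    by_contra! h
    obtain ⟨z, hz, hzy⟩ := hball (mem_ball_iff_norm.2 h)
    have := hinj (hRV (Metric.ball_subset_closedBall hz)) hy hzy
    subst this
    exact hRy.not_ge (mem_ball_iff_norm.1 hz).le
  set g := Function.invFunOn f (Metric.ball x R) with hg
  have hgm : ∀ p ∈ Metric.ball (f x) ρ, g p ∈ Metric.ball x R := fun p hp =>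
    Function.invFunOn_mem (hball hp)
  have hgV : ∀ p ∈ Metric.ball (f x) ρ, g p ∈ V := fun p hp =>
    hRV (Metric.ball_subset_closedBall (hgm p hp))
  have hgf : ∀ p ∈ Metric.ball (f x) ρ, f (g p) = p := fun p hp =>
    Function.invFunOn_eq (hball hp)
  have hgc : ∀ p ∈ Metric.ball (f x) ρ, ContinuousAt g p := by
    intro p hp N hN
    have h1 := hopen (g p) (hgV p hp) _ (inter_mem hN (hV.mem_nhds (hgV p hp)))
    rw [hgf p hp] at h1
    change g ⁻¹' N ∈ 𝓝 p
    filter_upwards [h1, Metric.isOpen_ball.mem_nhds hp] with q hq hqB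
    obtain ⟨z, ⟨hzN, hzV⟩, rfl⟩ := hq
    rwa [mem_preimage, hinj (hgV _ hqB) hzV (hgf _ hqB)]
  have hgd : ∀ p ∈ Metric.ball (f x) ρ, HasFDerivAt g ((f' (g p)).symm : E →L[ℝ] E) p :=
    fun p hp => HasFDerivAt.of_local_left_inverse (hgc p hp) (hf _ (hgV p hp)).hasFDerivAt
      (by filter_upwards [Metric.isOpen_ball.mem_nhds hp] with q hq using hgf q hq)
  have hfx : f x ∈ Metric.ball (f x) ρ := Metric.mem_ball_self hρ0
  have hgx : g (f x) = x := hinj (hgV _ hfx) hxV (hgf _ hfx)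
  have hglip : ∀ p ∈ Metric.ball (f x) ρ, ‖g p - x‖ ≤ L * ρ := by
    intro p hp
    have h1 := (convex_ball (f x) ρ).norm_image_sub_le_of_norm_hasFDerivWithin_le
      (fun q hq => (hgd q hq).hasFDerivWithinAt) (fun q hq => hL _ (hgV q hq)) hfx hp
    rw [hgx] at h1
    exact h1.trans (mul_le_mul_of_nonneg_left (mem_ball_iff_norm.1 hp).le hL0)
  have hLρ : L * ρ < ‖z₀ - x‖ := by
    rw [hz₀x]
    exact (mul_le_mul_of_nonneg_left hρy hL0).trans_lt hR1
  have hN : {z | L * ρ < ‖z - x‖} ∩ V ∈ 𝓝 z₀ :=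
    inter_mem ((isOpen_lt continuous_const (by fun_prop)).mem_nhds hLρ) (hV.mem_nhds hz₀V)
  have hpath : Tendsto (fun c : ℝ => f x + c • (f z₀ - f x)) (𝓝[<] 1) (𝓝 (f z₀)) := by
    have : ContinuousAt (fun c : ℝ => f x + c • (f z₀ - f x)) 1 := by fun_prop
    have h2 := this.tendsto.mono_left (nhdsWithin_le_nhds (s := Iio (1 : ℝ)))
    simpa using h2
  have h01 : ∀ᶠ c : ℝ in 𝓝[<] 1, c ∈ Ioo (0 : ℝ) 1 := Ioo_mem_nhdsLT zero_lt_one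
  obtain ⟨c, ⟨z, ⟨hzN, hzV⟩, hzc⟩, hc0, hc1⟩ :=
    ((hpath.eventually (hopen z₀ hz₀V _ hN)).and h01).exists
  have hpB : f z ∈ Metric.ball (f x) ρ := by
    rw [hzc, mem_ball_iff_norm, add_sub_cancel_left, norm_smul, Real.norm_of_nonneg hc0.le]
    exact mul_lt_of_lt_one_left hρ0 hc1
  have h3 := hglip _ hpB
  rw [hinj (hgV _ hpB) hzV (hgf _ hpB)] at h3
  exact h3.not_gt hzN

end InverseLipschitz

section Conformal

theorem _root_.IsConformalMap.norm_apply {E F : Type*} [NormedAddCommGroup E] [NormedSpace ℝ E]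
    [NormedAddCommGroup F] [NormedSpace ℝ F] {A : E →L[ℝ] F} (hA : IsConformalMap A) (u : E) :
    ‖A u‖ = ‖A‖ * ‖u‖ := by
  rcases subsingleton_or_nontrivial E with hE | hE
  · simp [Subsingleton.elim u 0]
  obtain ⟨c, -, li, rfl⟩ := hA
  rw [norm_smul, LinearIsometry.norm_toContinuousLinearMap, mul_one]
  simp [norm_smul]

theorem _root_.IsConformalMap.norm_comp {E F G : Type*} [NormedAddCommGroup E] [NormedSpace ℝ E]
    [NormedAddCommGroup F] [NormedSpace ℝ F] [NormedAddCommGroup G] [NormedSpace ℝ G]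
    [Nontrivial E] {A : F →L[ℝ] G} {B : E →L[ℝ] F} (hA : IsConformalMap A)
    (hB : IsConformalMap B) : ‖A.comp B‖ = ‖A‖ * ‖B‖ := by
  obtain ⟨u, hu⟩ := exists_ne (0 : E)
  have h1 := IsConformalMap.norm_apply (hA.comp hB) u
  rw [ContinuousLinearMap.comp_apply, IsConformalMap.norm_apply hA, IsConformalMap.norm_apply hB,
    ← mul_assoc] at h1
  exact (mul_right_cancel₀ (norm_ne_zero_iff.2 hu) h1).symm

theorem _root_.IsConformalMap.exists_equiv {E : Type*} [NormedAddCommGroup E] [NormedSpace ℝ E]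
    [FiniteDimensional ℝ E] [Nontrivial E] {A : E →L[ℝ] E} (hA : IsConformalMap A) :
    ∃ e : E ≃L[ℝ] E, (e : E →L[ℝ] E) = A ∧ ‖(e.symm : E →L[ℝ] E)‖ ≤ ‖A‖⁻¹ := by
  refine ⟨(LinearEquiv.ofInjectiveEndo (A : E →ₗ[ℝ] E) hA.injective).toContinuousLinearEquiv,
    by ext; rfl, ?_⟩
  refine ContinuousLinearMap.opNorm_le_bound _ (by positivity) fun v => ?_
  set e := (LinearEquiv.ofInjectiveEndo (A : E →ₗ[ℝ] E) hA.injective).toContinuousLinearEquiv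
  have h1 : A (e.symm v) = v := e.apply_symm_apply v
  have h2 := IsConformalMap.norm_apply hA (e.symm v)
  rw [h1] at h2
  have h3 : ‖A‖ ≠ 0 := norm_ne_zero_iff.2 hA.ne_zero
  rw [h2, inv_mul_cancel_left₀ h3]
  rfl

variable {m : ℕ} {V : Set (Euc m)} {f g : Euc m → Euc m}

theorem IsConformalDiffeoOn.differentiableAt (hf : IsConformalDiffeoOn f V) (hV : IsOpen V)
    {x : Euc m} (hx : x ∈ V) : DifferentiableAt ℝ f x :=
  (hf.1.contDiffAt (hV.mem_nhds hx)).differentiableAt one_ne_zero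

theorem IsConformalDiffeoOn.id (V : Set (Euc m)) : IsConformalDiffeoOn (id : Euc m → Euc m) V :=
  ⟨contDiffOn_id, injOn_id V, fun x _ => by rw [fderiv_id]; exact isConformalMap_id⟩

theorem IsConformalDiffeoOn.comp (hg : IsConformalDiffeoOn g V) (hf : IsConformalDiffeoOn f V)
    (hV : IsOpen V) (hmaps : MapsTo f V V) : IsConformalDiffeoOn (g ∘ f) V :=
  ⟨hg.1.comp hf.1 hmaps, hg.2.1.comp hf.2.1 hmaps, fun x hx => by
    rw [fderiv_comp x (hg.differentiableAt hV (hmaps hx)) (hf.differentiableAt hV hx)]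
    exact (hg.2.2 _ (hmaps hx)).comp (hf.2.2 x hx)⟩

theorem scaling_comp (hm : 0 < m) (hg : IsConformalDiffeoOn g V) (hf : IsConformalDiffeoOn f V)
    (hV : IsOpen V) (hmaps : MapsTo f V V) {x : Euc m} (hx : x ∈ V) :
    scaling (g ∘ f) x = scaling g (f x) * scaling f x := by
  have : Nonempty (Fin m) := ⟨⟨0, hm⟩⟩
  rw [scaling, fderiv_comp x (hg.differentiableAt hV (hmaps hx)) (hf.differentiableAt hV hx)]
  exact IsConformalMap.norm_comp (hg.2.2 _ (hmaps hx)) (hf.2.2 x hx)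

theorem IsConformalDiffeoOn.scaling_pos (hm : 0 < m) (hf : IsConformalDiffeoOn f V) {x : Euc m}
    (hx : x ∈ V) : 0 < scaling f x := by
  have : Nonempty (Fin m) := ⟨⟨0, hm⟩⟩
  exact norm_pos_iff.2 (hf.2.2 x hx).ne_zero

theorem IsConformalDiffeoOn.min_norm_sub_le (hm : 0 < m) (hf : IsConformalDiffeoOn f V)
    (hV : IsOpen V) {l : ℝ} (hl : 0 < l) (hlf : ∀ z ∈ V, l ≤ scaling f z) {x y : Euc m} {r : ℝ}
    (hr : 0 < r) (hx : Metric.closedBall x r ⊆ V) (hy : y ∈ V) :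
    l * min ‖y - x‖ r ≤ ‖f y - f x‖ := by
  have : Nonempty (Fin m) := ⟨⟨0, hm⟩⟩
  choose! e he1 he2 using fun z (hz : z ∈ V) => IsConformalMap.exists_equiv (hf.2.2 z hz)
  have h1 := min_norm_sub_le_mul_norm_image_sub (f' := e) hV hf.2.1 (fun z hz => by
    rw [he1 z hz]
    exact (hf.1.contDiffAt (hV.mem_nhds hz)).hasStrictFDerivAt one_ne_zero) (L := l⁻¹)
    (fun z hz => (he2 z hz).trans (inv_anti₀ hl (hlf z hz))) hr hx hy
  rwa [inv_mul_eq_div, le_div_iff₀' hl] at h1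

/-- Conformal diffeomorphisms expand distances on a compact subset of their domain by at least a
fixed multiple of the least scaling factor. -/
theorem exists_mul_norm_sub_le (hm : 0 < m) {X : Set (Euc m)} (hX : IsCompact X) (hV : IsOpen V)
    (hXV : X ⊆ V) :
    ∃ c : ℝ, 0 < c ∧ ∀ (f : Euc m → Euc m) (l : ℝ), IsConformalDiffeoOn f V → 0 < l →
      (∀ z ∈ V, l ≤ scaling f z) → ∀ x ∈ X, ∀ y ∈ X, c * l * ‖y - x‖ ≤ ‖f y - f x‖ := by
  obtain ⟨r, hr, hrV⟩ := hX.exists_cthickening_subset_open hV hXV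
  have hD := Metric.diam_nonneg (s := X)
  refine ⟨r / (Metric.diam X + r), by positivity, fun f l hf hl hlf x hx y hy => ?_⟩
  have h1 := hf.min_norm_sub_le hm hV hl hlf hr
    ((Metric.closedBall_subset_cthickening hx r).trans hrV) (hXV hy)
  refine le_trans ?_ h1
  have h2 : ‖y - x‖ ≤ Metric.diam X := by
    rw [← dist_eq_norm]
    exact Metric.dist_le_diam_of_mem hX.isBounded hy hx
  rw [mul_right_comm, mul_comm]
  refine mul_le_mul_of_nonneg_left ?_ hl.le
  rw [div_mul_eq_mul_div, div_le_iff₀ (by positivity)]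
  rcases le_total ‖y - x‖ r with h | h
  · rw [min_eq_left h]
    nlinarith [norm_nonneg (y - x)]
  · rw [min_eq_right h]
    nlinarith [norm_nonneg (y - x)]

end Conformal

section Words

variable {I : ℕ → Type u} {n k j : ℕ}

/-- The first `k` letters of a word of length `k + j`. -/
def FinWord.front (v : FinWord I n (k + j)) : FinWord I n k :=
  fun p => v ⟨p, p.2.1, by have := p.2.2; omega⟩

/-- The last `j` letters of a word of length `k + j`. -/
def FinWord.back (v : FinWord I n (k + j)) : FinWord I (n + k) j :=
  fun p => v ⟨p, by have := p.2.1; omega, by have := p.2.2; omega⟩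

/-- Deletion of the first `k` letters of an infinite word. -/
def InfWord.shift (ω : InfWord I n) (k : ℕ) : InfWord I (n + k) :=
  fun p => ω ⟨p, (Nat.le_add_right n k).trans p.2⟩

theorem FinWord.bijective_front_back :
    Function.Bijective fun v : FinWord I n (k + j) => (v.front, v.back) := by
  constructor
  · intro v v' hv
    funext ⟨p, hp1, hp2⟩
    by_cases hp : p < n + k
    · exact congrFun (congrArg Prod.fst hv) ⟨p, hp1, hp⟩
    · exact congrFun (congrArg Prod.snd hv) ⟨p, not_lt.1 hp, by omega⟩
  · rintro ⟨w, w'⟩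
    refine ⟨fun p => if hp : (p : ℕ) < n + k then w ⟨p, p.2.1, hp⟩ else
      w' ⟨p, not_lt.1 hp, by have := p.2.2; omega⟩, Prod.ext ?_ ?_⟩
    · funext p
      exact dif_pos p.2.2
    · funext p
      exact dif_neg (not_lt.2 p.2.1)

/-- A word of length `k + j` consists of its first `k` and its last `j` letters. -/
noncomputable def FinWord.splitEquiv (I : ℕ → Type u) (n k j : ℕ) :
    FinWord I n (k + j) ≃ FinWord I n k × FinWord I (n + k) j :=
  Equiv.ofBijective _ FinWord.bijective_front_back

theorem apply_letter_congr {m : ℕ} (φ : ∀ j, I j → Euc m → Euc m) {s : Set ℕ} (v : ∀ p : s, I p)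
    {p q : ℕ} (hpq : p = q) (hp : p ∈ s) (hq : q ∈ s) : φ p (v ⟨p, hp⟩) = φ q (v ⟨q, hq⟩) := by
  subst hpq
  rfl

theorem wordMap_add {m : ℕ} (φ : ∀ j, I j → Euc m → Euc m) (n k : ℕ) :
    ∀ (j : ℕ) (v : FinWord I n (k + j)),
      wordMap φ n (k + j) v = wordMap φ n k v.front ∘ wordMap φ (n + k) j v.back
  | 0, _ => rfl
  | j + 1, v => by
    have h1 : φ (n + (k + j)) (FinWord.last (j := k + j) v) = φ (n + k + j) v.back.last :=
      apply_letter_congr φ v (add_assoc n k j).symm _ _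
    calc wordMap φ n (k + (j + 1)) v
        = wordMap φ n (k + j) (FinWord.init (j := k + j) v)
            ∘ φ (n + (k + j)) (FinWord.last (j := k + j) v) := rfl
      _ = _ := by
        rw [h1, wordMap_add φ n k j]
        rfl

theorem wordMap_take_add {m : ℕ} (φ : ∀ j, I j → Euc m → Euc m) (ω : InfWord I n) (k j : ℕ) :
    wordMap φ n (k + j) (ω.take (k + j))
      = wordMap φ n k (ω.take k) ∘ wordMap φ (n + k) j ((ω.shift k).take j) :=
  wordMap_add φ n k j (ω.take (k + j))

theorem FinWord.exists_take [∀ j, Nonempty (I j)] (w : FinWord I n j) :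
    ∃ τ : InfWord I n, τ.take j = w :=
  FinWord.exists_take_eq (Classical.arbitrary _) w

end Words

section Distortion

variable {m d : ℕ} {I : ℕ → Type u} [∀ j, TopologicalSpace (I j)]
  {X V : Set (Euc m)} {U : Set (Euc d)} {φ : Euc d → ∀ j, I j → Euc m → Euc m}

theorem IsTNCIFS.mapsTo_wordMap_V (h : IsTNCIFS X V U φ) {t : Euc d} (ht : t ∈ U) (n : ℕ) :
    ∀ (j : ℕ) (ω : FinWord I n j), MapsTo (wordMap (φ t) n j ω) V V
  | 0, _ => fun _ hx => hx
  | j + 1, ω => (h.mapsTo_wordMap_V ht n j ω.init).comp (h.mapsTo_V t ht (n + j) ω.last)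

theorem IsTNCIFS.isConformalDiffeoOn_wordMap (h : IsTNCIFS X V U φ) {t : Euc d} (ht : t ∈ U)
    (n : ℕ) : ∀ (j : ℕ) (ω : FinWord I n j), IsConformalDiffeoOn (wordMap (φ t) n j ω) V
  | 0, _ => IsConformalDiffeoOn.id V
  | j + 1, ω => (h.isConformalDiffeoOn_wordMap ht n j ω.init).comp
      (h.conformal t ht (n + j) ω.last) h.isOpen_V (h.mapsTo_V t ht (n + j) ω.last)

theorem IsTNCIFS.scalingSup_le (h : IsTNCIFS X V U φ) {t : Euc d} {n j : ℕ} {w : FinWord I n j}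
    {c : ℝ} (hc : ∀ x ∈ X, scaling (wordMap (φ t) n j w) x ≤ c) :
    scalingSup (wordMap (φ t) n j w) X ≤ c :=
  csSup_le (h.nonempty_X.image _) (by rintro _ ⟨x, hx, rfl⟩; exact hc x hx)

theorem IsTNCIFS.scaling_wordMap_add (h : IsTNCIFS X V U φ) (hm : 0 < m) {t : Euc d} (ht : t ∈ U)
    {n k j : ℕ} (v : FinWord I n (k + j)) {x : Euc m} (hx : x ∈ V) :
    scaling (wordMap (φ t) n (k + j) v) x
      = scaling (wordMap (φ t) n k v.front) (wordMap (φ t) (n + k) j v.back x)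
        * scaling (wordMap (φ t) (n + k) j v.back) x := by
  rw [wordMap_add]
  exact scaling_comp hm (h.isConformalDiffeoOn_wordMap ht n k _)
    (h.isConformalDiffeoOn_wordMap ht (n + k) j _) h.isOpen_V (h.mapsTo_wordMap_V ht _ _ _) hx

variable [∀ j, Nonempty (I j)]

theorem IsTNCIFS.exists_scaling_le_pow (h : IsTNCIFS X V U φ) :
    ∃ γ : ℝ, 0 < γ ∧ γ < 1 ∧ ∀ t ∈ U, ∀ (n j : ℕ) (w : FinWord I n j), ∀ x ∈ V,
      scaling (wordMap (φ t) n j w) x ≤ γ ^ j := by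
  obtain ⟨γ, h0, h1, hγ⟩ := h.uniform_contraction
  refine ⟨γ, h0, h1, fun t ht n j w x hx => ?_⟩
  obtain ⟨τ, rfl⟩ := w.exists_take
  exact hγ t ht n τ j x hx

theorem IsTNCIFS.bddAbove_scaling (h : IsTNCIFS X V U φ) {t : Euc d} (ht : t ∈ U) {n j : ℕ}
    (w : FinWord I n j) : BddAbove (scaling (wordMap (φ t) n j w) '' X) := by
  obtain ⟨γ, -, -, hγ⟩ := h.exists_scaling_le_pow
  refine ⟨γ ^ j, ?_⟩
  rintro _ ⟨x, hx, rfl⟩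
  exact hγ t ht n j w x (h.X_subset_V hx)

theorem IsTNCIFS.scaling_le_scalingSup (h : IsTNCIFS X V U φ) {t : Euc d} (ht : t ∈ U) {n j : ℕ}
    (w : FinWord I n j) {x : Euc m} (hx : x ∈ X) :
    scaling (wordMap (φ t) n j w) x ≤ scalingSup (wordMap (φ t) n j w) X :=
  le_csSup (h.bddAbove_scaling ht w) (mem_image_of_mem _ hx)

theorem IsTNCIFS.scalingSup_pos (h : IsTNCIFS X V U φ) (hm : 0 < m) {t : Euc d} (ht : t ∈ U)
    {n j : ℕ} (w : FinWord I n j) : 0 < scalingSup (wordMap (φ t) n j w) X := by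
  obtain ⟨x, hx⟩ := h.nonempty_X
  exact ((h.isConformalDiffeoOn_wordMap ht n j w).scaling_pos hm (h.X_subset_V hx)).trans_le
    (h.scaling_le_scalingSup ht w hx)

/-- The bounded distortion constant, in terms of the supremum norm. -/
theorem IsTNCIFS.exists_distortion (h : IsTNCIFS X V U φ) :
    ∃ K : Euc d → ℝ, ContinuousOn K U ∧ (∀ t ∈ U, 1 ≤ K t) ∧
      ∀ t ∈ U, ∀ (n j : ℕ) (w : FinWord I n j), ∀ x ∈ V,
        scalingSup (wordMap (φ t) n j w) X ≤ K t * scaling (wordMap (φ t) n j w) x := by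
  obtain ⟨K, hKc, hK1, hK⟩ := h.bounded_distortion
  refine ⟨K, hKc, hK1, fun t ht n j w x hx => h.scalingSup_le fun y hy => ?_⟩
  obtain ⟨τ, rfl⟩ := w.exists_take
  exact hK t ht n τ j y (h.X_subset_V hy) x hx

theorem IsTNCIFS.scalingSup_add_le (h : IsTNCIFS X V U φ) (hm : 0 < m) {t : Euc d} (ht : t ∈ U)
    {n k j : ℕ} (v : FinWord I n (k + j)) :
    scalingSup (wordMap (φ t) n (k + j) v) X
      ≤ scalingSup (wordMap (φ t) n k v.front) X
        * scalingSup (wordMap (φ t) (n + k) j v.back) X := by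
  refine h.scalingSup_le fun x hx => ?_
  rw [h.scaling_wordMap_add hm ht v (h.X_subset_V hx)]
  exact mul_le_mul (h.scaling_le_scalingSup ht _ (h.mapsTo_wordMap_X ht _ _ _ hx))
    (h.scaling_le_scalingSup ht _ hx) (norm_nonneg _) (h.scalingSup_pos hm ht _).le

theorem IsTNCIFS.scalingSup_mul_le (h : IsTNCIFS X V U φ) (hm : 0 < m) {t : Euc d} (ht : t ∈ U)
    {K : ℝ} (hK1 : 1 ≤ K) (hK : ∀ (n j : ℕ) (w : FinWord I n j), ∀ x ∈ V,
      scalingSup (wordMap (φ t) n j w) X ≤ K * scaling (wordMap (φ t) n j w) x)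
    {n k j : ℕ} (v : FinWord I n (k + j)) :
    scalingSup (wordMap (φ t) n k v.front) X * scalingSup (wordMap (φ t) (n + k) j v.back) X
      ≤ K * scalingSup (wordMap (φ t) n (k + j) v) X := by
  have hpos := h.scalingSup_pos hm ht v.front
  rw [← le_div_iff₀' hpos]
  refine h.scalingSup_le fun x hx => ?_
  rw [le_div_iff₀' hpos]
  have hxV := h.X_subset_V hx
  calc scalingSup (wordMap (φ t) n k v.front) X * scaling (wordMap (φ t) (n + k) j v.back) x
      ≤ K * scaling (wordMap (φ t) n k v.front) (wordMap (φ t) (n + k) j v.back x)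
          * scaling (wordMap (φ t) (n + k) j v.back) x :=
        mul_le_mul_of_nonneg_right (hK _ _ _ _ (h.mapsTo_wordMap_V ht _ _ _ hxV)) (norm_nonneg _)
    _ = K * scaling (wordMap (φ t) n (k + j) v) x := by
        rw [h.scaling_wordMap_add hm ht v hxV, mul_assoc]
    _ ≤ _ := mul_le_mul_of_nonneg_left (h.scaling_le_scalingSup ht v hx) (by linarith)

theorem IsTNCIFS.norm_wordMap_sub_le (h : IsTNCIFS X V U φ) {t : Euc d} (ht : t ∈ U)
    {n j : ℕ} (w : FinWord I n j) {x y : Euc m} (hx : x ∈ X) (hy : y ∈ X) :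
    ‖wordMap (φ t) n j w y - wordMap (φ t) n j w x‖
      ≤ scalingSup (wordMap (φ t) n j w) X * ‖y - x‖ :=
  h.convex_X.norm_image_sub_le_of_norm_fderiv_le (𝕜 := ℝ)
    (fun _ hz => (h.isConformalDiffeoOn_wordMap ht n j w).differentiableAt h.isOpen_V
      (h.X_subset_V hz)) (fun _ hz => h.scaling_le_scalingSup ht w hz) hx hy

end Distortion

section Address

variable {m d : ℕ} {I : ℕ → Type u} [∀ j, TopologicalSpace (I j)]
  {X V : Set (Euc m)} {U : Set (Euc d)} {φ : Euc d → ∀ j, I j → Euc m → Euc m}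

theorem IsTNCIFS.address_mem_image (h : IsTNCIFS X V U φ) {t : Euc d} (ht : t ∈ U) (n : ℕ)
    (ω : InfWord I n) (j : ℕ) :
    address X (φ t) n ω ∈ wordMap (φ t) n (j + 1) (ω.take (j + 1)) '' X :=
  mem_iInter.1 (h.address_mem ht n ω) j

theorem IsTNCIFS.address_mem_X (h : IsTNCIFS X V U φ) {t : Euc d} (ht : t ∈ U) (n : ℕ)
    (ω : InfWord I n) : address X (φ t) n ω ∈ X := by
  obtain ⟨x, hx, hxe⟩ := h.address_mem_image ht n ω 0
  rw [← hxe]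
  exact h.mapsTo_wordMap_X ht n 1 _ hx

/-- Deleting the first `k` letters of a word amounts to removing the map `φ_{ω|_k}`. -/
theorem IsTNCIFS.address_eq_wordMap_shift (h : IsTNCIFS X V U φ) {t : Euc d} (ht : t ∈ U) (n : ℕ)
    (ω : InfWord I n) (k : ℕ) :
    address X (φ t) n ω
      = wordMap (φ t) n k (ω.take k) (address X (φ t) (n + k) (ω.shift k)) := by
  refine (h.existsUnique_mem_iInter ht n ω).unique (h.address_mem ht n ω) (mem_iInter.2 fun j => ?_)
  obtain ⟨x, hx, hxe⟩ := h.address_mem_image ht (n + k) (ω.shift k) j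
  rw [← hxe]
  have h1 := congrFun (wordMap_take_add (φ t) ω k (j + 1)) x
  rw [Function.comp_apply] at h1
  rw [← h1, add_comm k (j + 1), wordMap_take_add (φ t) ω (j + 1) k, Function.comp_apply]
  exact mem_image_of_mem _ (h.mapsTo_wordMap_X ht _ _ _ hx)

end Address

section Gibbs

variable {I : ℕ → Type u} [∀ j, TopologicalSpace (I j)]

theorem InfWord.continuous_take (n j : ℕ) :
    Continuous fun ω : InfWord I n => ω.take j :=
  continuous_pi fun _ => continuous_apply _

variable [∀ j, DiscreteTopology (I j)]

theorem InfWord.isOpen_cylinder {n j : ℕ} (w : FinWord I n j) :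
    IsOpen {ω : InfWord I n | ω.take j = w} :=
  (isOpen_discrete {w}).preimage (InfWord.continuous_take n j)

variable [∀ j, Finite (I j)]

theorem exists_gibbs_approx {n : ℕ} [MeasurableSpace (InfWord I n)] [BorelSpace (InfWord I n)]
    [∀ j, Nonempty (I j)] (A : ∀ n j, FinWord I n j → ℝ≥0∞)
    (hA0 : ∀ n j w, A n j w ≠ 0) (hAt : ∀ n j w, A n j w ≠ ∞) {κ : ℝ≥0∞}
    (hsub : ∀ n k j (v : FinWord I n (k + j)), A n (k + j) v ≤ A n k v.front * A (n + k) j v.back)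
    (hsup : ∀ n k j (v : FinWord I n (k + j)),
      A n k v.front * A (n + k) j v.back ≤ κ * A n (k + j) v) (N : ℕ) :
    ∃ μ : Measure (InfWord I n), IsProbabilityMeasure μ ∧ ∀ k ≤ N, ∀ w : FinWord I n k,
      μ {ω | ω.take k = w} ≤ κ * A n k w / ∑' w', A n k w' := by
  classical
  have := fun j => Fintype.ofFinite (FinWord I n j)
  choose ext hext using fun v : FinWord I n N => v.exists_take
  have hZ0 : ∀ p q, ∑' w, A p q w ≠ 0 := fun p q h0 =>
    hA0 p q (Classical.arbitrary _) (ENNReal.tsum_eq_zero.1 h0 _)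
  have hZt : ∀ p q, ∑' w, A p q w ≠ ∞ := fun p q => by
    have := Fintype.ofFinite (FinWord I p q)
    rw [tsum_fintype]
    exact ENNReal.sum_ne_top.2 fun w _ => hAt p q w
  set Z := ∑' v, A n N v with hZ
  set μ : Measure (InfWord I n) := Z⁻¹ • Measure.sum fun v => A n N v • Measure.dirac (ext v)
    with hμ
  have happ : ∀ s, MeasurableSet s → μ s = Z⁻¹ * ∑' v, A n N v * s.indicator 1 (ext v) := by
    intro s hs
    simp only [hμ, Measure.smul_apply, smul_eq_mul, Measure.sum_apply _ hs,
      Measure.dirac_apply' _ hs]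
  refine ⟨μ, ⟨?_⟩, fun k hk w => ?_⟩
  · rw [happ _ MeasurableSet.univ]
    simp only [indicator_univ, Pi.one_apply, mul_one]
    exact ENNReal.inv_mul_cancel (hZ0 n N) (hZt n N)
  obtain ⟨j, rfl⟩ := Nat.exists_eq_add_of_le hk
  rw [happ _ (InfWord.isOpen_cylinder w).measurableSet]
  have hind : ∀ v : FinWord I n (k + j),
      ({ω | ω.take k = w} : Set (InfWord I n)).indicator (1 : InfWord I n → ℝ≥0∞) (ext v)
        = if v.front = w then 1 else 0 := by
    intro v
    have h1 : (ext v).take k = v.front := by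
      conv_rhs => rw [← hext v]
      rfl
    simp [indicator_apply, h1]
  have hS : ∑' v, A n (k + j) v * ({ω | ω.take k = w} : Set (InfWord I n)).indicator
      (1 : InfWord I n → ℝ≥0∞) (ext v) ≤ A n k w * ∑' u, A (n + k) j u := by
    calc _ ≤ ∑' v : FinWord I n (k + j),
            (if v.front = w then A n k v.front else 0) * A (n + k) j v.back := by
          refine ENNReal.tsum_le_tsum fun v => ?_
          rw [hind]
          split_ifs
          · rw [mul_one]
            exact hsub n k j v
          · simp
      _ = ∑' p : FinWord I n k × FinWord I (n + k) j,
            (if p.1 = w then A n k p.1 else 0) * A (n + k) j p.2 :=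
          (FinWord.splitEquiv I n k j).tsum_eq
            fun p => (if p.1 = w then A n k p.1 else 0) * A (n + k) j p.2
      _ = A n k w * ∑' u, A (n + k) j u := by
          rw [ENNReal.tsum_prod
            (f := fun p q => (if p = w then A n k p else 0) * A (n + k) j q)]
          simp_rw [ENNReal.tsum_mul_left]
          rw [tsum_eq_single w fun w' hw' => by simp [hw'], if_pos rfl]
  have hT : (∑' w', A n k w') * ∑' u, A (n + k) j u ≤ κ * Z := by
    calc (∑' w', A n k w') * ∑' u, A (n + k) j u
        = ∑' p : FinWord I n k × FinWord I (n + k) j, A n k p.1 * A (n + k) j p.2 := by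
          rw [ENNReal.tsum_prod (f := fun p q => A n k p * A (n + k) j q)]
          simp_rw [ENNReal.tsum_mul_left, ENNReal.tsum_mul_right]
      _ = ∑' v : FinWord I n (k + j), A n k v.front * A (n + k) j v.back :=
          ((FinWord.splitEquiv I n k j).tsum_eq fun p => A n k p.1 * A (n + k) j p.2).symm
      _ ≤ ∑' v, κ * A n (k + j) v := ENNReal.tsum_le_tsum fun v => hsup n k j v
      _ = κ * Z := ENNReal.tsum_mul_left
  rw [ENNReal.le_div_iff_mul_le (Or.inl (hZ0 n k)) (Or.inl (hZt n k))]
  calc _ ≤ Z⁻¹ * (A n k w * ∑' u, A (n + k) j u) * ∑' w', A n k w' := by gcongr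
    _ = Z⁻¹ * A n k w * ((∑' w', A n k w') * ∑' u, A (n + k) j u) := by ring
    _ ≤ Z⁻¹ * A n k w * (κ * Z) := by gcongr
    _ = (Z⁻¹ * Z) * (κ * A n k w) := by ring
    _ = κ * A n k w := by rw [ENNReal.inv_mul_cancel (hZ0 n _) (hZt n _), one_mul]

/-- For almost multiplicative weights on finite words there is a probability measure on the
infinite words that gives cylinders at most a constant times their normalized weights. -/
theorem exists_gibbs {n : ℕ} [MeasurableSpace (InfWord I n)] [BorelSpace (InfWord I n)]
    [∀ j, Nonempty (I j)] (A : ∀ n j, FinWord I n j → ℝ≥0∞)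
    (hA0 : ∀ n j w, A n j w ≠ 0) (hAt : ∀ n j w, A n j w ≠ ∞) {κ : ℝ≥0∞}
    (hsub : ∀ n k j (v : FinWord I n (k + j)), A n (k + j) v ≤ A n k v.front * A (n + k) j v.back)
    (hsup : ∀ n k j (v : FinWord I n (k + j)),
      A n k v.front * A (n + k) j v.back ≤ κ * A n (k + j) v) :
    ∃ μ : Measure (InfWord I n), IsProbabilityMeasure μ ∧ ∀ k, ∀ w : FinWord I n k,
      μ {ω | ω.take k = w} ≤ κ * A n k w / ∑' w', A n k w' := by
  choose μ hμp hμ using exists_gibbs_approx (n := n) A hA0 hAt hsub hsup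
  let ν : ℕ → ProbabilityMeasure (InfWord I n) := fun N => ⟨μ N, hμp N⟩
  obtain ⟨ν₀, -, hν₀⟩ := (isCompact_univ (X := ProbabilityMeasure (InfWord I n))).ultrafilter_le_nhds
    ((Filter.hyperfilter ℕ).map ν) (by simp)
  have hlim : Tendsto ν (Filter.hyperfilter ℕ : Filter ℕ) (𝓝 ν₀) := hν₀
  refine ⟨ν₀, inferInstance, fun k w => ?_⟩
  refine (ProbabilityMeasure.le_liminf_measure_open_of_tendsto hlim
    (InfWord.isOpen_cylinder w)).trans (liminf_le_of_frequently_le' (Eventually.frequently ?_))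
  have hev : ∀ᶠ N in (Filter.hyperfilter ℕ : Filter ℕ), k ≤ N :=
    Nat.hyperfilter_le_atTop (eventually_ge_atTop k)
  filter_upwards [hev] with N hN using hμ N k hN w

end Gibbs

section Pairs

variable {I : ℕ → Type u}

theorem InfWord.exists_take_eq_head_shift_ne {n : ℕ} {ω τ : InfWord I n} (hne : ω ≠ τ) :
    ∃ k, ω.take k = τ.take k ∧ (ω.shift k).head ≠ (τ.shift k).head := by
  classical
  have hex : ∃ k, (ω.shift k).head ≠ (τ.shift k).head := by
    by_contra! hcon
    refine hne (funext fun ⟨p, hp⟩ => ?_)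
    obtain ⟨k, rfl⟩ := Nat.exists_eq_add_of_le (show n ≤ p from hp)
    exact hcon k
  refine ⟨Nat.find hex, funext fun ⟨p, hp1, hp2⟩ => ?_, Nat.find_spec hex⟩
  obtain ⟨k, rfl⟩ := Nat.exists_eq_add_of_le hp1
  exact not_not.1 (Nat.find_min hex (show k < Nat.find hex by omega))

variable [∀ j, TopologicalSpace (I j)]

theorem InfWord.continuous_head_shift (n k : ℕ) :
    Continuous fun ω : InfWord I n => (ω.shift k).head :=
  continuous_apply _

variable [∀ j, DiscreteTopology (I j)]

/-- The pairs of infinite words whose longest common prefix is `w` form an open set. -/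
theorem InfWord.isOpen_setOf_branching {n k : ℕ} (w : FinWord I n k) :
    IsOpen {p : InfWord I n × InfWord I n | (p.1.take k = w ∧ p.2.take k = w) ∧
      (p.1.shift k).head ≠ (p.2.shift k).head} := by
  refine (((isOpen_cylinder w).preimage continuous_fst).inter
    ((isOpen_cylinder w).preimage continuous_snd)).inter ?_
  exact (isOpen_discrete {q : I (n + k) × I (n + k) | q.1 ≠ q.2}).preimage
    (((continuous_head_shift n k).comp continuous_fst).prodMk
      ((continuous_head_shift n k).comp continuous_snd))

variable [∀ j, Finite (I j)] {n : ℕ} [MeasurableSpace (InfWord I n)] [BorelSpace (InfWord I n)]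

theorem tsum_measure_cylinder (μ : Measure (InfWord I n)) [IsProbabilityMeasure μ] (k : ℕ) :
    ∑' w : FinWord I n k, μ {ω | ω.take k = w} = 1 := by
  have h1 := measure_iUnion (μ := μ) (f := fun w : FinWord I n k => {ω | ω.take k = w})
    (fun w w' hw => Set.disjoint_left.2 fun ω h1 h2 => hw ((show ω.take k = w from h1).symm.trans h2))
    fun w => (InfWord.isOpen_cylinder w).measurableSet
  rw [← h1, ← measure_univ (μ := μ)]
  congr 1
  exact eq_univ_of_forall fun ω => mem_iUnion.2 ⟨_, rfl⟩

theorem measure_diagonal_eq_zero (μ : Measure (InfWord I n)) [IsProbabilityMeasure μ]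
    {e : ℕ → ℝ≥0∞} (he : Tendsto e atTop (𝓝 0))
    (hμe : ∀ k (w : FinWord I n k), μ {ω | ω.take k = w} ≤ e k) :
    (μ.prod μ) (diagonal (InfWord I n)) = 0 := by
  refine le_antisymm (ge_of_tendsto' he fun k => ?_) zero_le
  calc (μ.prod μ) (diagonal (InfWord I n))
      ≤ (μ.prod μ) (⋃ w : FinWord I n k, {ω | ω.take k = w} ×ˢ {ω | ω.take k = w}) := by
        refine measure_mono fun p hp => mem_iUnion.2 ⟨p.1.take k, rfl, ?_⟩
        rw [mem_diagonal_iff] at hp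
        rw [hp]
        rfl
    _ ≤ ∑' w : FinWord I n k, μ {ω | ω.take k = w} * μ {ω | ω.take k = w} := by
        refine (measure_iUnion_le _).trans (le_of_eq ?_)
        simp_rw [Measure.prod_prod]
    _ ≤ ∑' w : FinWord I n k, e k * μ {ω | ω.take k = w} :=
        ENNReal.tsum_le_tsum fun w => by gcongr; exact hμe k w
    _ = e k := by rw [ENNReal.tsum_mul_left, tsum_measure_cylinder, mul_one]

/-- To integrate over pairs of words, split according to their longest common prefix. -/
theorem lintegral_prod_le_tsum (μ : Measure (InfWord I n)) [IsProbabilityMeasure μ]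
    {e : ℕ → ℝ≥0∞} (he : Tendsto e atTop (𝓝 0))
    (hμe : ∀ k (w : FinWord I n k), μ {ω | ω.take k = w} ≤ e k)
    {F : InfWord I n × InfWord I n → ℝ≥0∞} {B : ∀ k, FinWord I n k → ℝ≥0∞} {b : ℕ → ℝ≥0∞}
    (hF : ∀ (ω τ : InfWord I n) (k : ℕ), ω.take k = τ.take k →
      (ω.shift k).head ≠ (τ.shift k).head → F (ω, τ) ≤ B k (ω.take k))
    (hb : ∀ k (w : FinWord I n k), B k w * μ {ω | ω.take k = w} ≤ b k) :
    ∫⁻ p, F p ∂(μ.prod μ) ≤ ∑' k, b k := by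
  set S : (k : ℕ) → FinWord I n k → Set (InfWord I n × InfWord I n) := fun k w =>
    {p | (p.1.take k = w ∧ p.2.take k = w) ∧ (p.1.shift k).head ≠ (p.2.shift k).head} with hS
  have hcover : (univ : Set (InfWord I n × InfWord I n)) ⊆ diagonal _ ∪ ⋃ k, ⋃ w, S k w := by
    rintro ⟨ω, τ⟩ -
    by_cases hne : ω = τ
    · exact Or.inl hne
    · obtain ⟨k, h1, h2⟩ := InfWord.exists_take_eq_head_shift_ne hne
      exact Or.inr (mem_iUnion₂.2 ⟨k, ω.take k, ⟨rfl, h1.symm⟩, h2⟩)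
  have hSm : ∀ k w, MeasurableSet (S k w) := fun k w =>
    (InfWord.isOpen_setOf_branching w).measurableSet
  have hSle : ∀ k w, ∫⁻ p in S k w, F p ∂(μ.prod μ) ≤ b k * μ {ω | ω.take k = w} := by
    intro k w
    calc ∫⁻ p in S k w, F p ∂(μ.prod μ) ≤ ∫⁻ _ in S k w, B k w ∂(μ.prod μ) := by
          refine setLIntegral_mono' (hSm k w) ?_
          rintro ⟨ω, τ⟩ ⟨⟨h1, h2⟩, h3⟩
          have h4 := hF ω τ k (h1.trans h2.symm) h3
          rwa [show ω.take k = w from h1] at h4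
      _ = B k w * (μ.prod μ) (S k w) := setLIntegral_const _ _
      _ ≤ B k w * (μ.prod μ) ({ω | ω.take k = w} ×ˢ {ω | ω.take k = w}) := by
          gcongr
          exact fun p hp => hp.1
      _ = B k w * μ {ω | ω.take k = w} * μ {ω | ω.take k = w} := by
          rw [Measure.prod_prod, mul_assoc]
      _ ≤ b k * μ {ω | ω.take k = w} := by
          gcongr
          exact hb k w
  calc ∫⁻ p, F p ∂(μ.prod μ) = ∫⁻ p in univ, F p ∂(μ.prod μ) := by rw [Measure.restrict_univ]
    _ ≤ ∫⁻ p in diagonal _ ∪ ⋃ k, ⋃ w, S k w, F p ∂(μ.prod μ) := lintegral_mono_set hcover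
    _ ≤ ∫⁻ p in diagonal _, F p ∂(μ.prod μ) + ∫⁻ p in ⋃ k, ⋃ w, S k w, F p ∂(μ.prod μ) :=
        lintegral_union_le _ _ _
    _ = ∫⁻ p in ⋃ k, ⋃ w, S k w, F p ∂(μ.prod μ) := by
        rw [setLIntegral_measure_zero _ _ (measure_diagonal_eq_zero μ he hμe), zero_add]
    _ ≤ ∑' k, ∑' w, ∫⁻ p in S k w, F p ∂(μ.prod μ) :=
        (lintegral_iUnion_le _ _).trans (ENNReal.tsum_le_tsum fun k => lintegral_iUnion_le _ _)
    _ ≤ ∑' k, ∑' w : FinWord I n k, b k * μ {ω | ω.take k = w} :=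
        ENNReal.tsum_le_tsum fun k => ENNReal.tsum_le_tsum fun w => hSle k w
    _ = ∑' k, b k := by simp_rw [ENNReal.tsum_mul_left, tsum_measure_cylinder, mul_one]

end Pairs

section Pressure

theorem tsum_ne_top_of_eventually_le {f : ℕ → ℝ≥0∞} (hf : ∀ k, f k ≠ ∞) {g : ℕ → ℝ}
    (hg0 : ∀ k, 0 ≤ g k) (hg : Summable g) (h : ∀ᶠ k in atTop, f k ≤ ENNReal.ofReal (g k)) :
    ∑' k, f k ≠ ∞ := by
  obtain ⟨N, hN⟩ := eventually_atTop.1 h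
  rw [← ENNReal.summable.sum_add_tsum_nat_add' (k := N)]
  refine ENNReal.add_ne_top.2 ⟨ENNReal.sum_ne_top.2 fun k _ => hf k, ?_⟩
  refine ne_top_of_le_ne_top ?_ (ENNReal.tsum_le_tsum fun k => hN (k + N) (Nat.le_add_left _ _))
  rw [← ENNReal.ofReal_tsum_of_nonneg (fun k => hg0 _) ((summable_nat_add_iff N).2 hg)]
  exact ENNReal.ofReal_ne_top

variable {m : ℕ} {I : ℕ → Type u}

/-- Positive pressure means exponential growth of the partition sums. -/
theorem exists_exp_le_partitionSum {X : Set (Euc m)} {φ : ∀ j, I j → Euc m → Euc m} {s : ℝ≥0}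
    (h : 0 < lowerPressure X φ s) :
    ∃ c : ℝ, 0 < c ∧ ∀ᶠ n : ℕ in atTop, ENNReal.ofReal (Real.exp (c * n)) ≤ partitionSum X φ n s := by
  obtain ⟨c, hc0, hc⟩ := EReal.lt_iff_exists_real_btwn.1 h
  refine ⟨c, by exact_mod_cast hc0, ?_⟩
  filter_upwards [eventually_lt_of_lt_liminf hc, eventually_gt_atTop 0] with n hn hn0
  have h1 := (EReal.lt_div_iff (by exact_mod_cast hn0) (EReal.natCast_ne_top n)).1 hn
  rw [← EReal.coe_natCast, ← EReal.coe_mul] at h1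
  rw [← ENNReal.log_strictMono.le_iff_le, ENNReal.log_ofReal_of_pos (Real.exp_pos _), Real.log_exp]
  exact h1.le

end Pressure

section Energy

variable {m d : ℕ} {I : ℕ → Type u} [∀ j, TopologicalSpace (I j)] [∀ j, Nonempty (I j)]
  {X V : Set (Euc m)} {U : Set (Euc d)} {φ : Euc d → ∀ j, I j → Euc m → Euc m}

/-- Near a parameter `t₀`, the distance of two points of a limit set is bounded below in terms of
their longest common prefix and the scaling factors at `t₀`. -/
theorem IsTNCIFS.exists_mul_norm_address_sub_le (h : IsTNCIFS X V U φ) (hm : 0 < m) {t₀ : Euc d}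
    (ht₀ : t₀ ∈ U) {η : ℝ} (hη : 0 < η) :
    ∃ δ : ℝ, 0 < δ ∧ Metric.closedBall t₀ δ ⊆ U ∧ ∃ q : ℝ, 0 < q ∧
      ∀ t ∈ Metric.closedBall t₀ δ, ∀ (n k : ℕ) (ω τ : InfWord I n), ω.take k = τ.take k →
        q * Real.exp (-(k * η)) * scalingSup (wordMap (φ t₀) n k (ω.take k)) X
          * ‖address X (φ t) (n + k) (ω.shift k) - address X (φ t) (n + k) (τ.shift k)‖
          ≤ ‖address X (φ t) n ω - address X (φ t) n τ‖ := by
  obtain ⟨δ₁, hδ₁, hδ⟩ := h.distortion_continuity η hη t₀ ht₀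
  obtain ⟨δ₂, hδ₂, hδU⟩ := Metric.nhds_basis_closedBall.mem_iff.1 (h.isOpen_U.mem_nhds ht₀)
  obtain ⟨K, hKc, hK1, hK⟩ := h.exists_distortion
  obtain ⟨c, hc0, hc⟩ := exists_mul_norm_sub_le hm h.isCompact_X h.isOpen_V h.X_subset_V
  have hGU : Metric.closedBall t₀ (min δ₁ δ₂) ⊆ U :=
    (Metric.closedBall_subset_closedBall (min_le_right _ _)).trans hδU
  obtain ⟨K₀, hK₀⟩ := (isCompact_closedBall t₀ (min δ₁ δ₂)).exists_bound_of_continuousOn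
    (hKc.mono hGU)
  have hKK : ∀ t ∈ Metric.closedBall t₀ (min δ₁ δ₂), K t ≤ K₀ := fun t ht =>
    (Real.le_norm_self _).trans (hK₀ t ht)
  have hK₀1 : 1 ≤ K₀ :=
    (hK1 t₀ ht₀).trans (hKK t₀ (Metric.mem_closedBall_self (lt_min hδ₁ hδ₂).le))
  refine ⟨min δ₁ δ₂, lt_min hδ₁ hδ₂, hGU, c / K₀, by positivity, fun t ht n k ω τ hωτ => ?_⟩
  have htU := hGU ht
  have htδ : ‖t - t₀‖ ≤ δ₁ := (mem_closedBall_iff_norm.1 ht).trans (min_le_left _ _)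
  have ha₀ := h.scalingSup_pos hm ht₀ (ω.take k)
  have ha := h.scalingSup_pos hm htU (ω.take k)
  set a₀ := scalingSup (wordMap (φ t₀) n k (ω.take k)) X
  set a := scalingSup (wordMap (φ t) n k (ω.take k)) X
  have haa : Real.exp (-(k * η)) * a₀ ≤ a := by
    have h1 := (hδ t htU htδ n ω k).2
    rw [div_le_iff₀ ha] at h1
    rw [Real.exp_neg, inv_mul_le_iff₀ (Real.exp_pos _)]
    exact h1
  have hl : ∀ z ∈ V, Real.exp (-(k * η)) * a₀ / K₀ ≤ scaling (wordMap (φ t) n k (ω.take k)) z := by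
    intro z hz
    rw [div_le_iff₀' (by positivity)]
    exact haa.trans ((hK t htU n k _ z hz).trans
      (mul_le_mul_of_nonneg_right (hKK t ht) (norm_nonneg _)))
  have h2 := hc _ _ (h.isConformalDiffeoOn_wordMap htU n k (ω.take k)) (by positivity) hl _
    (h.address_mem_X htU (n + k) (τ.shift k)) _ (h.address_mem_X htU (n + k) (ω.shift k))
  rw [h.address_eq_wordMap_shift htU n ω k, h.address_eq_wordMap_shift htU n τ k, ← hωτ]
  refine le_trans (le_of_eq ?_) h2
  ring

theorem measure_le_add_mul_rpow {x v : ℝ≥0∞} {C ρ : ℝ} (hC : 0 < C) (hρ : 0 < ρ) {s : ℝ≥0} {m : ℕ}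
    (hs : s ≤ m) (h1 : x ≤ v) (h2 : x ≤ ENNReal.ofReal (C * ρ ^ m)) :
    x ≤ (v + ENNReal.ofReal C) * ENNReal.ofReal ρ ^ (s : ℝ) := by
  rcases le_total ρ 1 with hρ1 | hρ1
  · calc x ≤ ENNReal.ofReal C * ENNReal.ofReal ρ ^ (m : ℝ) := by
          rwa [ENNReal.rpow_natCast, ← ENNReal.ofReal_pow hρ.le, ← ENNReal.ofReal_mul hC.le]
      _ ≤ (v + ENNReal.ofReal C) * ENNReal.ofReal ρ ^ (s : ℝ) := by
          refine mul_le_mul' le_add_self ?_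
          exact ENNReal.rpow_le_rpow_of_exponent_ge (ENNReal.ofReal_le_one.2 hρ1)
            (by exact_mod_cast hs)
  · calc x ≤ (v + ENNReal.ofReal C) * 1 := by
          rw [mul_one]
          exact h1.trans le_self_add
      _ ≤ (v + ENNReal.ofReal C) * ENNReal.ofReal ρ ^ (s : ℝ) := by
          gcongr
          calc (1 : ℝ≥0∞) = 1 ^ (s : ℝ) := (ENNReal.one_rpow _).symm
            _ ≤ _ := ENNReal.rpow_le_rpow (ENNReal.one_le_ofReal.2 hρ1) s.coe_nonneg

theorem IsTNCIFS.partitionSum_ne_zero (h : IsTNCIFS X V U φ) (hm : 0 < m) {t : Euc d}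
    (ht : t ∈ U) (k : ℕ) (s : ℝ≥0) : partitionSum X (φ t) k s ≠ 0 := fun h0 =>
  (ENNReal.rpow_pos (ENNReal.ofReal_pos.2 (h.scalingSup_pos hm ht (Classical.arbitrary _)))
    ENNReal.ofReal_ne_top).ne' (ENNReal.tsum_eq_zero.1 h0 (Classical.arbitrary (FinWord I 0 k)))

theorem IsTNCIFS.scalingSup_le_one (h : IsTNCIFS X V U φ) {t : Euc d} (ht : t ∈ U) {n k : ℕ}
    (w : FinWord I n k) : scalingSup (wordMap (φ t) n k w) X ≤ 1 := by
  obtain ⟨γ, hγ0, hγ1, hγ⟩ := h.exists_scaling_le_pow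
  exact h.scalingSup_le fun x hx =>
    (hγ t ht n k w x (h.X_subset_V hx)).trans (pow_le_one₀ hγ0.le hγ1.le)

variable [∀ j, Finite (I j)] [∀ j, DiscreteTopology (I j)]

theorem IsTNCIFS.exists_gibbs (h : IsTNCIFS X V U φ) (hm : 0 < m) {t₀ : Euc d}
    (ht₀ : t₀ ∈ U) (s : ℝ≥0) [MeasurableSpace (InfWord I 0)] [BorelSpace (InfWord I 0)] :
    ∃ μ : Measure (InfWord I 0), IsProbabilityMeasure μ ∧ ∃ κ : ℝ≥0∞, κ ≠ ∞ ∧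
      ∀ k (w : FinWord I 0 k), μ {ω | ω.take k = w}
        ≤ κ * ENNReal.ofReal (scalingSup (wordMap (φ t₀) 0 k w) X) ^ (s : ℝ)
          / partitionSum X (φ t₀) k s := by
  obtain ⟨K, -, hK1, hK⟩ := h.exists_distortion
  have hK0 : 0 ≤ K t₀ := zero_le_one.trans (hK1 t₀ ht₀)
  have hpos : ∀ n j (w : FinWord I n j), 0 < scalingSup (wordMap (φ t₀) n j w) X :=
    fun n j w => h.scalingSup_pos hm ht₀ w
  obtain ⟨μ, hμ, hμk⟩ := NonautonomousIFS.exists_gibbs (n := 0)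
    (fun n j w => ENNReal.ofReal (scalingSup (wordMap (φ t₀) n j w) X) ^ (s : ℝ))
    (fun n j w => (ENNReal.rpow_pos (ENNReal.ofReal_pos.2 (hpos n j w)) ENNReal.ofReal_ne_top).ne')
    (fun n j w => ENNReal.rpow_ne_top_of_nonneg s.coe_nonneg ENNReal.ofReal_ne_top)
    (κ := ENNReal.ofReal (K t₀) ^ (s : ℝ))
    (fun n k j v => by
      rw [← ENNReal.mul_rpow_of_nonneg _ _ s.coe_nonneg, ← ENNReal.ofReal_mul (hpos _ _ _).le]
      exact ENNReal.rpow_le_rpow (ENNReal.ofReal_le_ofReal (h.scalingSup_add_le hm ht₀ v)) s.coe_nonneg)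
    (fun n k j v => by
      rw [← ENNReal.mul_rpow_of_nonneg _ _ s.coe_nonneg, ← ENNReal.mul_rpow_of_nonneg _ _ s.coe_nonneg,
        ← ENNReal.ofReal_mul (hpos _ _ _).le, ← ENNReal.ofReal_mul hK0]
      exact ENNReal.rpow_le_rpow (ENNReal.ofReal_le_ofReal
        (h.scalingSup_mul_le hm ht₀ (hK1 t₀ ht₀) (hK t₀ ht₀) v)) s.coe_nonneg)
  exact ⟨μ, hμ, _, ENNReal.rpow_ne_top_of_nonneg s.coe_nonneg ENNReal.ofReal_ne_top, hμk⟩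

/-- Exponential growth of the partition sums beats subexponential transversality constants. -/
theorem tsum_transversality_ne_top {v : ℝ≥0∞} (hv : v ≠ ∞) {C : ℕ → ℝ} (hC : ∀ n, 0 < C n)
    (hCl : Tendsto (fun n : ℕ => Real.log (C n) / ((n : ℝ) + 1)) atTop (𝓝 0))
    {Z : ℕ → ℝ≥0∞} (hZ0 : ∀ k, Z k ≠ 0) {c : ℝ} (hc : 0 < c)
    (hZ : ∀ᶠ k : ℕ in atTop, ENNReal.ofReal (Real.exp (c * k)) ≤ Z k) {a : ℝ} (ha : a ≤ c / 4) :
    ∑' k : ℕ, (v + ENNReal.ofReal (C k)) * ENNReal.ofReal (Real.exp (k * a)) / Z k ≠ ∞ := by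
  refine tsum_ne_top_of_eventually_le (g := fun k : ℕ =>
    (v.toReal + Real.exp (c / 4)) * Real.exp (k * (-(c / 2)))) (fun k => ?_)
    (fun k => by positivity) ((Real.summable_exp_nat_mul_iff.2 (by linarith)).mul_left _) ?_
  · exact ENNReal.div_ne_top (ENNReal.mul_ne_top (by simp [hv]) ENNReal.ofReal_ne_top) (hZ0 k)
  filter_upwards [hZ, hCl.eventually (gt_mem_nhds (show (0 : ℝ) < c / 4 by positivity))]
    with k hk hCk
  rw [div_lt_iff₀ (by positivity), Real.log_lt_iff_lt_exp (hC k)] at hCk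
  calc (v + ENNReal.ofReal (C k)) * ENNReal.ofReal (Real.exp (k * a)) / Z k
      ≤ (v + ENNReal.ofReal (C k)) * ENNReal.ofReal (Real.exp (k * a))
          / ENNReal.ofReal (Real.exp (c * k)) := by gcongr
    _ = ENNReal.ofReal ((v.toReal + C k) * Real.exp (k * a) / Real.exp (c * k)) := by
        have := hC k
        conv_lhs => rw [← ENNReal.ofReal_toReal hv]
        rw [← ENNReal.ofReal_add ENNReal.toReal_nonneg (hC k).le, ← ENNReal.ofReal_mul (by positivity),
          ← ENNReal.ofReal_div_of_pos (Real.exp_pos _)]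
    _ ≤ _ := by
        refine ENNReal.ofReal_le_ofReal ?_
        have hk0 : (0 : ℝ) ≤ k := Nat.cast_nonneg k
        have h1 : v.toReal + C k ≤ (v.toReal + Real.exp (c / 4)) * Real.exp (k * (c / 4)) := by
          have h2 : 1 ≤ Real.exp (k * (c / 4)) := Real.one_le_exp (by positivity)
          have h3 : Real.exp (c / 4 * (k + 1)) = Real.exp (c / 4) * Real.exp (k * (c / 4)) := by
            rw [← Real.exp_add]
            ring_nf
          rw [h3] at hCk
          nlinarith [ENNReal.toReal_nonneg (a := v)]
        have h4 : Real.exp (k * a) ≤ Real.exp (k * (c / 4)) :=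
          Real.exp_le_exp.2 (mul_le_mul_of_nonneg_left ha hk0)
        calc (v.toReal + C k) * Real.exp (k * a) / Real.exp (c * k)
            ≤ (v.toReal + Real.exp (c / 4)) * Real.exp (k * (c / 4)) * Real.exp (k * (c / 4))
                / Real.exp (c * k) := by gcongr
          _ = (v.toReal + Real.exp (c / 4)) * Real.exp (k * (-(c / 2))) := by
              rw [mul_assoc, ← Real.exp_add, mul_div_assoc, ← Real.exp_sub]
              ring_nf

/-- The transversality estimate: at positive pressure there is a measure on the words such that, on
average over the parameters, pairs of points of the limit set at distance at most `r` have mass at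
most a constant times `r ^ s`. -/
theorem IsTNCIFS.exists_lintegral_volume_le (h : IsTNCIFS X V U φ) (hm : 0 < m) {t₀ : Euc d}
    (ht₀ : t₀ ∈ U) {s : ℝ≥0} (hs : s ≤ m) (hP : 0 < lowerPressure X (φ t₀) s)
    [MeasurableSpace (InfWord I 0)] [BorelSpace (InfWord I 0)] :
    ∃ δ : ℝ, 0 < δ ∧ Metric.closedBall t₀ δ ⊆ U ∧ ∃ μ : Measure (InfWord I 0),
      IsProbabilityMeasure μ ∧ ∃ M : ℝ≥0∞, M ≠ ∞ ∧ ∀ r : ℝ, 0 < r →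
        ∫⁻ p, volume {t ∈ Metric.closedBall t₀ δ |
          ‖address X (φ t) 0 p.1 - address X (φ t) 0 p.2‖ ≤ r} ∂(μ.prod μ)
        ≤ M * ENNReal.ofReal r ^ (s : ℝ) := by
  obtain ⟨c, hc0, hc⟩ := exists_exp_le_partitionSum hP
  have hm1 : (0 : ℝ) < m := by exact_mod_cast hm
  obtain ⟨δ, hδ0, hδU, q, hq0, hq⟩ :=
    h.exists_mul_norm_address_sub_le hm ht₀ (show 0 < c / (4 * m) by positivity)
  set η := c / (4 * m) with hη
  have hηs : η * s ≤ c / 4 := by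
    calc η * s ≤ η * m := by
          gcongr
          exact_mod_cast hs
      _ = c / 4 := by
          rw [hη]
          field_simp
  obtain ⟨C, hC0, hCl, hC⟩ := h.transversality _ (isCompact_closedBall t₀ δ) hδU
  obtain ⟨μ, hμ, κ, hκ, hμκ⟩ := h.exists_gibbs hm ht₀ s
  set G := Metric.closedBall t₀ δ
  set Z : ℕ → ℝ≥0∞ := fun k => partitionSum X (φ t₀) k s with hZ
  have hGv : volume G ≠ ∞ := measure_closedBall_lt_top.ne
  have hZ0 : ∀ k, Z k ≠ 0 := fun k => h.partitionSum_ne_zero hm ht₀ k s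
  have hsum := tsum_transversality_ne_top hGv hC0 hCl hZ0 hc0 hc hηs
  have hZtop : Tendsto Z atTop (𝓝 ∞) := by
    refine tendsto_nhds_top_mono (ENNReal.tendsto_ofReal_atTop.comp
      (Real.tendsto_exp_atTop.comp ?_)) hc
    exact tendsto_natCast_atTop_atTop.const_mul_atTop hc0
  have he : Tendsto (fun k => κ / Z k) atTop (𝓝 0) := by
    simpa using ENNReal.Tendsto.const_div hZtop (Or.inr hκ)
  have hμe : ∀ k (w : FinWord I 0 k), μ {ω | ω.take k = w} ≤ κ / Z k := by
    intro k w
    refine (hμκ k w).trans ?_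
    gcongr
    calc κ * _ ≤ κ * 1 := by
          gcongr
          exact ENNReal.rpow_le_one (ENNReal.ofReal_le_one.2 (h.scalingSup_le_one ht₀ w)) s.coe_nonneg
      _ = κ := mul_one _
  refine ⟨δ, hδ0, hδU, μ, hμ, κ * ENNReal.ofReal q⁻¹ ^ (s : ℝ) * _,
    ENNReal.mul_ne_top (ENNReal.mul_ne_top hκ
      (ENNReal.rpow_ne_top_of_nonneg s.coe_nonneg ENNReal.ofReal_ne_top)) hsum, fun r hr => ?_⟩
  set a : ∀ k, FinWord I 0 k → ℝ := fun k w => scalingSup (wordMap (φ t₀) 0 k w) X with ha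
  have ha0 : ∀ k w, 0 < a k w := fun k w => h.scalingSup_pos hm ht₀ w
  have hmain := lintegral_prod_le_tsum μ he hμe
    (F := fun p => volume {t ∈ G | ‖address X (φ t) 0 p.1 - address X (φ t) 0 p.2‖ ≤ r})
    (B := fun k w => (volume G + ENNReal.ofReal (C k))
      * ENNReal.ofReal (r / (q * Real.exp (-(k * η)) * a k w)) ^ (s : ℝ))
    (b := fun k => κ * ENNReal.ofReal q⁻¹ ^ (s : ℝ) * ENNReal.ofReal r ^ (s : ℝ)
      * ((volume G + ENNReal.ofReal (C k)) * ENNReal.ofReal (Real.exp (k * (η * s))) / Z k))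
    (fun ω τ k h1 h2 => ?_) (fun k w => ?_)
  · refine hmain.trans (le_of_eq ?_)
    rw [ENNReal.tsum_mul_left]
    ring
  · have hl : 0 < q * Real.exp (-(k * η)) * a k (ω.take k) := by
      have := ha0 k (ω.take k)
      positivity
    refine measure_le_add_mul_rpow (hC0 k) (div_pos hr hl) hs (measure_mono fun t ht => ht.1) ?_
    have h3 := hC (0 + k) (ω.shift k) (τ.shift k) h2 _ (div_pos hr hl)
    rw [show C (0 + k) = C k by rw [zero_add]] at h3
    refine (measure_mono ?_).trans h3
    rintro t ⟨htG, htr⟩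
    refine ⟨htG, ?_⟩
    rw [le_div_iff₀' hl]
    exact (hq t htG 0 k ω τ h1).trans htr
  · have hx : ENNReal.ofReal (r / (q * Real.exp (-(k * η)) * a k w)) ^ (s : ℝ)
        * ENNReal.ofReal (a k w) ^ (s : ℝ)
        = ENNReal.ofReal q⁻¹ ^ (s : ℝ) * ENNReal.ofReal r ^ (s : ℝ)
          * ENNReal.ofReal (Real.exp (k * (η * s))) := by
      have h4 : Real.exp (k * (η * s)) = Real.exp (k * η) ^ (s : ℝ) := by
        rw [← Real.exp_mul, mul_assoc]
      have := ha0 k w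
      rw [h4, ← ENNReal.ofReal_rpow_of_nonneg (Real.exp_pos _).le s.coe_nonneg,
        ← ENNReal.mul_rpow_of_nonneg _ _ s.coe_nonneg, ← ENNReal.mul_rpow_of_nonneg _ _ s.coe_nonneg,
        ← ENNReal.mul_rpow_of_nonneg _ _ s.coe_nonneg, ← ENNReal.ofReal_mul (by positivity),
        ← ENNReal.ofReal_mul (by positivity), ← ENNReal.ofReal_mul (by positivity), Real.exp_neg]
      congr 2
      field_simp
    calc _ ≤ (volume G + ENNReal.ofReal (C k))
            * ENNReal.ofReal (r / (q * Real.exp (-(k * η)) * a k w)) ^ (s : ℝ)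
            * (κ * ENNReal.ofReal (a k w) ^ (s : ℝ) / Z k) := by
          gcongr
          exact hμκ k w
      _ = (volume G + ENNReal.ofReal (C k)) * κ
            * (ENNReal.ofReal (r / (q * Real.exp (-(k * η)) * a k w)) ^ (s : ℝ)
              * ENNReal.ofReal (a k w) ^ (s : ℝ)) / Z k := by
          simp only [div_eq_mul_inv]
          ring
      _ = _ := by
          rw [hx]
          simp only [div_eq_mul_inv]
          ring

end Energy

section UpperBound

variable {m d : ℕ} {I : ℕ → Type u} [∀ j, TopologicalSpace (I j)] [∀ j, Nonempty (I j)]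
  {X V : Set (Euc m)} {U : Set (Euc d)} {φ : Euc d → ∀ j, I j → Euc m → Euc m}

theorem IsTNCIFS.lowerPressure_antitone (h : IsTNCIFS X V U φ) {t : Euc d} (ht : t ∈ U) :
    Antitone (lowerPressure X (φ t)) := by
  intro a b hab
  refine liminf_le_liminf (Eventually.of_forall fun n => ?_)
  refine EReal.div_le_div_right_of_nonneg (by positivity) (ENNReal.log_monotone
    (ENNReal.tsum_le_tsum fun w => ?_))
  exact ENNReal.rpow_le_rpow_of_exponent_ge
    (ENNReal.ofReal_le_one.2 (h.scalingSup_le_one ht w)) (by exact_mod_cast hab)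

theorem IsTNCIFS.ediam_image_wordMap_le (h : IsTNCIFS X V U φ) {t : Euc d} (ht : t ∈ U) {n j : ℕ}
    (w : FinWord I n j) :
    Metric.ediam (wordMap (φ t) n j w '' X)
      ≤ ENNReal.ofReal (scalingSup (wordMap (φ t) n j w) X) * Metric.ediam X := by
  refine Metric.ediam_le ?_
  rintro _ ⟨x, hx, rfl⟩ _ ⟨y, hy, rfl⟩
  calc edist (wordMap (φ t) n j w x) (wordMap (φ t) n j w y)
      ≤ ENNReal.ofReal (scalingSup (wordMap (φ t) n j w) X * ‖x - y‖) := by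
        rw [edist_dist, dist_eq_norm]
        exact ENNReal.ofReal_le_ofReal (h.norm_wordMap_sub_le ht w hy hx)
    _ = ENNReal.ofReal (scalingSup (wordMap (φ t) n j w) X) * edist x y := by
        rw [ENNReal.ofReal_mul' (norm_nonneg _), edist_dist, dist_eq_norm]
    _ ≤ _ := by
        gcongr
        exact Metric.edist_le_ediam_of_mem hx hy

variable [∀ j, Finite (I j)]

theorem IsTNCIFS.dimH_limitSet_le (h : IsTNCIFS X V U φ) {t : Euc d} (ht : t ∈ U) :
    dimH (limitSet X (φ t)) ≤ bowenDim X (φ t) := by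
  rw [h.bowenDim_eq_iInf ht]
  refine le_iInf₂ fun s hs => dimH_le_of_hausdorffMeasure_ne_top ?_
  obtain ⟨γ, hγ0, hγ1, hγ⟩ := h.exists_scaling_le_pow
  have hXt : Metric.ediam X ≠ ∞ := h.isCompact_X.isBounded.ediam_ne_top
  have hr : Tendsto (fun n : ℕ => ENNReal.ofReal (γ ^ n) * Metric.ediam X) atTop (𝓝 0) := by
    have h1 := ENNReal.Tendsto.mul_const (b := Metric.ediam X)
      (ENNReal.tendsto_ofReal (tendsto_pow_atTop_nhds_zero_of_lt_one hγ0.le hγ1)) (Or.inr hXt)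
    simpa using h1
  have hle := Measure.hausdorffMeasure_le_liminf_tsum (s : ℝ) (limitSet X (φ t)) _ hr
    (fun n (w : FinWord I 0 n) => wordMap (φ t) 0 n w '' X)
    (Eventually.of_forall fun n w => (h.ediam_image_wordMap_le ht w).trans (by
      gcongr
      exact h.scalingSup_le fun x hx => hγ t ht 0 n w x (h.X_subset_V hx)))
    (Eventually.of_forall fun n => by
      rintro _ ⟨ω, rfl⟩
      rw [h.address_eq_wordMap_shift ht 0 ω n]
      exact mem_iUnion.2 ⟨_, mem_image_of_mem _ (h.address_mem_X ht _ _)⟩)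
  have hfr : ∃ᶠ n : ℕ in atTop, ENNReal.log (partitionSum X (φ t) n s) / (n : EReal) < 0 :=
    frequently_lt_of_liminf_lt (by isBoundedDefault) hs
  refine ne_top_of_le_ne_top (ENNReal.rpow_ne_top_of_nonneg s.coe_nonneg hXt)
    (hle.trans (liminf_le_of_frequently_le' (hfr.mono fun n hn => ?_)))
  have hZ : partitionSum X (φ t) n s ≤ 1 := by
    by_contra! h1
    exact hn.not_ge (EReal.div_nonneg (ENNReal.zero_lt_log_iff.2 h1).le (by positivity))
  calc ∑' w : FinWord I 0 n, Metric.ediam (wordMap (φ t) 0 n w '' X) ^ (s : ℝ)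
      ≤ ∑' w : FinWord I 0 n, ENNReal.ofReal (scalingSup (wordMap (φ t) 0 n w) X) ^ (s : ℝ)
          * Metric.ediam X ^ (s : ℝ) := by
        refine ENNReal.tsum_le_tsum fun w => ?_
        rw [← ENNReal.mul_rpow_of_nonneg _ _ s.coe_nonneg]
        exact ENNReal.rpow_le_rpow (h.ediam_image_wordMap_le ht w) s.coe_nonneg
    _ = partitionSum X (φ t) n s * Metric.ediam X ^ (s : ℝ) := ENNReal.tsum_mul_right
    _ ≤ Metric.ediam X ^ (s : ℝ) := mul_le_of_le_one_left' hZ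

end UpperBound

section LowerBound

theorem map_ne_zero_of_isProbabilityMeasure {Ω E : Type*} [MeasurableSpace Ω] [MeasurableSpace E]
    (μ : Measure Ω) [IsProbabilityMeasure μ] {f : Ω → E} (hf : Measurable f) : μ.map f ≠ 0 := by
  have := Measure.isProbabilityMeasure_map (μ := μ) hf.aemeasurable
  exact IsProbabilityMeasure.ne_zero _

variable {m d : ℕ} {I : ℕ → Type u} [∀ j, TopologicalSpace (I j)] {X V : Set (Euc m)}
  {U : Set (Euc d)} {φ : Euc d → ∀ j, I j → Euc m → Euc m}

theorem IsTNCIFS.continuous_address (h : IsTNCIFS X V U φ) {t : Euc d} (ht : t ∈ U) (n : ℕ) :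
    Continuous (address X (φ t) n) :=
  continuousOn_univ.1 ((h.address_continuity n).comp (f := fun ω => (t, ω)) (by fun_prop)
    fun _ _ => ⟨ht, trivial⟩)

variable [∀ j, Finite (I j)]

theorem IsTNCIFS.isCompact_limitSet (h : IsTNCIFS X V U φ) {t : Euc d} (ht : t ∈ U) :
    IsCompact (limitSet X (φ t)) :=
  isCompact_range (h.continuous_address ht 0)

variable [MeasurableSpace (InfWord I 0)] [BorelSpace (InfWord I 0)]

theorem IsTNCIFS.map_address_compl_limitSet (h : IsTNCIFS X V U φ) {t : Euc d} (ht : t ∈ U)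
    (μ : Measure (InfWord I 0)) : μ.map (address X (φ t) 0) (limitSet X (φ t))ᶜ = 0 := by
  rw [Measure.map_apply (h.continuous_address ht 0).measurable
    (h.isCompact_limitSet ht).measurableSet.compl]
  convert measure_empty (μ := μ)
  exact eq_empty_of_forall_notMem fun ω hω => hω ⟨ω, rfl⟩

variable [∀ j, DiscreteTopology (I j)]

theorem IsTNCIFS.map_address_prod (h : IsTNCIFS X V U φ) {t : Euc d} (ht : t ∈ U)
    (μ : Measure (InfWord I 0)) [IsProbabilityMeasure μ] (r : ℝ) :
    ((μ.map (address X (φ t) 0)).prod (μ.map (address X (φ t) 0))) {p | dist p.1 p.2 ≤ r}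
      = (μ.prod μ) {p | ‖address X (φ t) 0 p.1 - address X (φ t) 0 p.2‖ ≤ r} := by
  have hm := (h.continuous_address ht 0).measurable
  rw [Measure.map_prod_map _ _ hm hm, Measure.map_apply (hm.prodMap hm) (measurableSet_dist_le r)]
  simp only [dist_eq_norm]
  rfl

theorem IsTNCIFS.measurableSet_norm_address_sub_le (h : IsTNCIFS X V U φ) {G : Set (Euc d)}
    (hG : IsClosed G) (hGU : G ⊆ U) (r : ℝ) :
    MeasurableSet {q : Euc d × (InfWord I 0 × InfWord I 0) |
      q.1 ∈ G ∧ ‖address X (φ q.1) 0 q.2.1 - address X (φ q.1) 0 q.2.2‖ ≤ r} := by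
  have hcont : ContinuousOn (fun q : Euc d × (InfWord I 0 × InfWord I 0) =>
      ‖address X (φ q.1) 0 q.2.1 - address X (φ q.1) 0 q.2.2‖) (Prod.fst ⁻¹' G) := by
    refine ContinuousOn.norm (ContinuousOn.sub ?_ ?_)
    · exact (h.address_continuity 0).comp (f := fun q : Euc d × (InfWord I 0 × InfWord I 0) =>
        (q.1, q.2.1)) (by fun_prop) fun q hq => ⟨hGU hq, trivial⟩
    · exact (h.address_continuity 0).comp (f := fun q : Euc d × (InfWord I 0 × InfWord I 0) =>
        (q.1, q.2.2)) (by fun_prop) fun q hq => ⟨hGU hq, trivial⟩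
  exact (hcont.preimage_isClosed_of_isClosed (hG.preimage continuous_fst)
    (isClosed_Iic (a := r))).measurableSet

variable [∀ j, Nonempty (I j)]

/-- Near a parameter of positive pressure, the limit sets carry measures for which the mass of
pairs of points at distance at most `r` is on average at most a constant times `r ^ s`. -/
theorem IsTNCIFS.exists_setLIntegral_le (h : IsTNCIFS X V U φ) (hm : 0 < m) {t₀ : Euc d}
    (ht₀ : t₀ ∈ U) {s : ℝ≥0} (hs : s ≤ m) (hP : 0 < lowerPressure X (φ t₀) s) :
    ∃ δ : ℝ, 0 < δ ∧ Metric.closedBall t₀ δ ⊆ U ∧ ∃ μ : Measure (InfWord I 0),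
      IsProbabilityMeasure μ ∧ ∃ M : ℝ≥0∞, M ≠ ∞ ∧ ∃ f : ℝ → Euc d → ℝ≥0∞,
        (∀ r, Measurable (f r)) ∧ (∀ r, ∀ t ∈ Metric.closedBall t₀ δ, f r t =
          ((μ.map (address X (φ t) 0)).prod (μ.map (address X (φ t) 0)))
            {p | dist p.1 p.2 ≤ r}) ∧
        ∀ r, 0 < r → ∫⁻ t in Metric.closedBall t₀ δ, f r t ≤ M * ENNReal.ofReal r ^ (s : ℝ) := by
  obtain ⟨δ, hδ, hδU, μ, hμ, M, hM, hle⟩ := h.exists_lintegral_volume_le hm ht₀ hs hP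
  have hmeas := h.measurableSet_norm_address_sub_le (G := Metric.closedBall t₀ δ)
    Metric.isClosed_closedBall hδU
  refine ⟨δ, hδ, hδU, μ, hμ, M, hM, _, fun r =>
    measurable_measure_prodMk_left (ν := μ.prod μ) (hmeas r), fun r t ht => ?_, fun r hr => ?_⟩
  · rw [h.map_address_prod (hδU ht)]
    congr 1
    ext p
    exact and_iff_right ht
  · refine (setLIntegral_le_lintegral _ _).trans ((le_of_eq ?_).trans (hle r hr))
    rw [← Measure.prod_apply (hmeas r), Measure.prod_apply_symm (hmeas r)]
    rfl

theorem IsTNCIFS.exists_ae_le_dimH (h : IsTNCIFS X V U φ) (hm : 0 < m) {t₀ : Euc d}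
    (ht₀ : t₀ ∈ U) {s q : ℝ≥0} (hs : s ≤ m) (hP : 0 < lowerPressure X (φ t₀) s) (hq0 : 0 < q)
    (hqs : q < s) :
    ∃ δ : ℝ, 0 < δ ∧ ∀ᵐ t ∂(volume.restrict (Metric.closedBall t₀ δ)),
      (q : ℝ≥0∞) ≤ dimH (limitSet X (φ t)) := by
  obtain ⟨δ, hδ, hδU, μ, hμ, M, hM, f, hfm, hf, hfi⟩ := h.exists_setLIntegral_le hm ht₀ hs hP
  refine ⟨δ, hδ, ?_⟩
  set ρ : ℕ → ℝ≥0∞ := fun n => ENNReal.ofReal ((1 / 2 : ℝ) ^ n) with hρ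
  have hρ0 : ∀ n, ρ n ≠ 0 := fun n => by
    simp only [hρ, Ne, ENNReal.ofReal_eq_zero, not_le]
    positivity
  have hterm : ∀ n, ∫⁻ t in Metric.closedBall t₀ δ, f ((1 / 2 : ℝ) ^ n) t / ρ n ^ (q : ℝ)
      ≤ M * (ENNReal.ofReal (1 / 2) ^ ((s : ℝ) - q)) ^ n := by
    intro n
    simp_rw [div_eq_mul_inv _ (ρ n ^ (q : ℝ))]
    rw [lintegral_mul_const _ (hfm _)]
    calc _ ≤ M * ρ n ^ (s : ℝ) * (ρ n ^ (q : ℝ))⁻¹ := by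
          gcongr
          exact hfi _ (by positivity)
      _ = M * ρ n ^ ((s : ℝ) - q) := by
          rw [ENNReal.rpow_sub _ _ (hρ0 n) ENNReal.ofReal_ne_top, mul_assoc, div_eq_mul_inv]
      _ = _ := by
          simp only [hρ]
          rw [ENNReal.ofReal_pow (by norm_num), ← ENNReal.rpow_natCast, ← ENNReal.rpow_natCast,
            ← ENNReal.rpow_mul, ← ENNReal.rpow_mul, mul_comm (n : ℝ)]
  have hgeom : ENNReal.ofReal (1 / 2) ^ ((s : ℝ) - q) < 1 :=
    ENNReal.rpow_lt_one (by rw [ENNReal.ofReal_lt_one]; norm_num)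
      (sub_pos.2 (by exact_mod_cast hqs))
  have hfin : ∫⁻ t in Metric.closedBall t₀ δ, ∑' n : ℕ, f ((1 / 2 : ℝ) ^ n) t / ρ n ^ (q : ℝ)
      ≠ ∞ := by
    rw [lintegral_tsum fun n => ((hfm _).div_const _).aemeasurable]
    refine ne_top_of_le_ne_top ?_ (ENNReal.tsum_le_tsum hterm)
    rw [ENNReal.tsum_mul_left, ENNReal.tsum_geometric]
    exact ENNReal.mul_ne_top hM (ENNReal.inv_ne_top.2 (tsub_pos_of_lt hgeom).ne')
  filter_upwards [ae_lt_top (Measurable.tsum fun n => (hfm _).div_const _) hfin,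
    ae_restrict_mem measurableSet_closedBall] with t ht htG
  simp only [hf _ t htG] at ht
  have hcm := (h.continuous_address (hδU htG) 0).measurable
  exact le_dimH_of_tsum_ne_top _ (map_ne_zero_of_isProbabilityMeasure μ hcm)
    (h.map_address_compl_limitSet (hδU htG) μ) hq0 ht.ne

theorem IsTNCIFS.exists_ae_volume_pos (h : IsTNCIFS X V U φ) (hm : 0 < m) {t₀ : Euc d}
    (ht₀ : t₀ ∈ U) (hP : 0 < lowerPressure X (φ t₀) m) :
    ∃ δ : ℝ, 0 < δ ∧ ∀ᵐ t ∂(volume.restrict (Metric.closedBall t₀ δ)),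
      0 < volume (limitSet X (φ t)) := by
  obtain ⟨δ, hδ, hδU, μ, hμ, M, hM, f, hfm, hf, hfi⟩ := h.exists_setLIntegral_le hm ht₀ le_rfl hP
  refine ⟨δ, hδ, ?_⟩
  set ρ : ℕ → ℝ≥0∞ := fun n => ENNReal.ofReal ((1 / 2 : ℝ) ^ n) ^ (m : ℝ) with hρ
  have hterm : ∀ n, ∫⁻ t in Metric.closedBall t₀ δ, f ((1 / 2 : ℝ) ^ n) t / ρ n ≤ M := by
    intro n
    simp_rw [div_eq_mul_inv _ (ρ n)]
    rw [lintegral_mul_const _ (hfm _), ← div_eq_mul_inv]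
    exact ENNReal.div_le_of_le_mul (hfi _ (by positivity))
  have hfin : ∫⁻ t in Metric.closedBall t₀ δ,
      liminf (fun n : ℕ => f ((1 / 2 : ℝ) ^ n) t / ρ n) atTop ≠ ∞ :=
    ne_top_of_le_ne_top hM ((lintegral_liminf_le fun n => (hfm _).div_const _).trans
      (liminf_le_of_frequently_le' (Frequently.of_forall hterm)))
  filter_upwards [ae_lt_top (Measurable.liminf fun n => (hfm _).div_const _) hfin,
    ae_restrict_mem measurableSet_closedBall] with t ht htG
  simp only [hf _ t htG] at ht
  have hcm := (h.continuous_address (hδU htG) 0).measurable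
  exact volume_pos_of_liminf_ne_top _ (map_ne_zero_of_isProbabilityMeasure μ hcm)
    (h.map_address_compl_limitSet (hδU htG) μ) ht.ne

end LowerBound

section Main

theorem measure_eq_zero_of_forall_exists_ae {E : Type*} [MetricSpace E] [SecondCountableTopology E]
    [MeasurableSpace E] [OpensMeasurableSpace E] {μ : Measure E} {N : Set E} {p : E → Prop}
    (hN : ∀ t ∈ N, ¬ p t)
    (h : ∀ t₀ ∈ N, ∃ δ : ℝ, 0 < δ ∧ ∀ᵐ t ∂(μ.restrict (Metric.closedBall t₀ δ)), p t) :
    μ N = 0 := by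
  refine measure_null_of_locally_null N fun t₀ ht₀ => ?_
  obtain ⟨δ, hδ, hae⟩ := h t₀ ht₀
  refine ⟨Metric.closedBall t₀ δ ∩ N,
    inter_mem (mem_nhdsWithin_of_mem_nhds (Metric.closedBall_mem_nhds _ hδ)) self_mem_nhdsWithin, ?_⟩
  rw [ae_restrict_iff' Metric.isClosed_closedBall.measurableSet] at hae
  refine measure_mono_null (fun t ht => ?_) hae
  exact fun hcon => hN t ht.2 (hcon ht.1)

theorem bowenDim_eq_zero_of_isEmpty {m : ℕ} {I : ℕ → Type u} (X : Set (Euc m)) (φ : ∀ j, I j → Euc m → Euc m) {k : ℕ}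
    (hk : IsEmpty (I k)) : bowenDim X φ = 0 := by
  refine le_antisymm (iSup₂_le fun s hs => ?_) zero_le
  obtain ⟨c, -, hc⟩ := exists_exp_le_partitionSum hs
  obtain ⟨n, hn, hkn⟩ := (hc.and (eventually_gt_atTop k)).exists
  have : IsEmpty (FinWord I 0 n) := ⟨fun ω => hk.false (ω ⟨k, Nat.zero_le k, by omega⟩)⟩
  have hz : partitionSum X φ n s = 0 := by simp [partitionSum]
  rw [hz] at hn
  exact absurd hn (ENNReal.ofReal_pos.2 (Real.exp_pos _)).not_ge

variable {m d : ℕ} {I : ℕ → Type u} [∀ j, TopologicalSpace (I j)]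
  [∀ j, Nonempty (I j)] [∀ j, Finite (I j)] [∀ j, DiscreteTopology (I j)]
  {X V : Set (Euc m)} {U : Set (Euc d)} {φ : Euc d → ∀ j, I j → Euc m → Euc m}

theorem IsTNCIFS.ae_min_le_dimH (h : IsTNCIFS X V U φ) (hm : 0 < m) :
    ∀ᵐ t ∂(volume : Measure (Euc d)), t ∈ U →
      min (m : ℝ≥0∞) (bowenDim X (φ t)) ≤ dimH (limitSet X (φ t)) := by
  let _ : MeasurableSpace (InfWord I 0) := borel _
  have : BorelSpace (InfWord I 0) := ⟨rfl⟩
  set N : ℚ → Set (Euc d) := fun q => {t | t ∈ U ∧ dimH (limitSet X (φ t)) < Real.toNNReal q ∧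
    (Real.toNNReal q : ℝ≥0∞) < min (m : ℝ≥0∞) (bowenDim X (φ t))} with hN
  have hN0 : ∀ q, volume (N q) = 0 := by
    intro q
    refine measure_eq_zero_of_forall_exists_ae
      (p := fun t => (Real.toNNReal q : ℝ≥0∞) ≤ dimH (limitSet X (φ t)))
      (fun t ht => ht.2.1.not_ge) ?_
    rintro t₀ ⟨ht₀, hq1, hq2⟩
    rw [lt_min_iff, bowenDim] at hq2
    obtain ⟨hqm, hqb⟩ := hq2
    simp only [lt_iSup_iff] at hqb
    obtain ⟨s, hs, hqs⟩ := hqb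
    refine h.exists_ae_le_dimH hm ht₀ (s := min s m) (min_le_right _ _)
      (hs.trans_le (h.lowerPressure_antitone ht₀ (min_le_left _ _)))
      (by exact_mod_cast zero_le.trans_lt hq1)
      (lt_min (by exact_mod_cast hqs) (by exact_mod_cast hqm))
  refine measure_mono_null (fun t ht => ?_) (measure_iUnion_null hN0)
  simp only [mem_compl_iff, mem_ofPred_eq, Classical.not_imp, not_le] at ht
  obtain ⟨htU, hlt⟩ := ht
  obtain ⟨q, -, hq⟩ := ENNReal.lt_iff_exists_rat_btwn.1 hlt
  exact mem_iUnion.2 ⟨q, htU, hq.1, hq.2⟩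

theorem IsTNCIFS.ae_volume_pos (h : IsTNCIFS X V U φ) (hm : 0 < m) :
    ∀ᵐ t ∂(volume : Measure (Euc d)), t ∈ U →
      (m : ℝ≥0∞) < bowenDim X (φ t) → 0 < volume (limitSet X (φ t)) := by
  let _ : MeasurableSpace (InfWord I 0) := borel _
  have : BorelSpace (InfWord I 0) := ⟨rfl⟩
  refine measure_mono_null (fun t ht => ?_) (measure_eq_zero_of_forall_exists_ae
    (N := {t | t ∈ U ∧ (m : ℝ≥0∞) < bowenDim X (φ t) ∧ ¬ 0 < volume (limitSet X (φ t))})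
    (p := fun t => 0 < volume (limitSet X (φ t))) (fun t ht => ht.2.2) ?_)
  · simp only [mem_compl_iff, mem_ofPred_eq, Classical.not_imp] at ht
    exact ht
  · rintro t₀ ⟨ht₀, hmb, -⟩
    simp only [bowenDim, lt_iSup_iff] at hmb
    obtain ⟨s, hs, hms⟩ := hmb
    exact h.exists_ae_volume_pos hm ht₀
      (hs.trans_le (h.lowerPressure_antitone ht₀ (by exact_mod_cast hms.le)))

end Main

end NonautonomousIFS

theorem theoremA {m d : ℕ} (hm : 0 < m) (hd : 0 < d)
    {I : ℕ → Type*} [∀ j, Finite (I j)] [∀ j, TopologicalSpace (I j)]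
    [∀ j, DiscreteTopology (I j)]
    (X V : Set (Euc m)) (U : Set (Euc d)) (φ : Euc d → ∀ j, I j → Euc m → Euc m)
    (h : NonautonomousIFS.IsTNCIFS X V U φ) :
    (∀ᵐ t ∂(volume : Measure (Euc d)), t ∈ U →
      dimH (NonautonomousIFS.limitSet X (φ t))
        = min (m : ℝ≥0∞) (NonautonomousIFS.bowenDim X (φ t))) ∧
    (∀ᵐ t ∂(volume : Measure (Euc d)), t ∈ U →
      (m : ℝ≥0∞) < NonautonomousIFS.bowenDim X (φ t) →
        0 < volume (NonautonomousIFS.limitSet X (φ t))) := by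
  by_cases hI : ∀ j, Nonempty (I j)
  · refine ⟨?_, h.ae_volume_pos hm⟩
    filter_upwards [h.ae_min_le_dimH hm] with t ht htU
    refine le_antisymm (le_min ?_ (h.dimH_limitSet_le htU)) (ht htU)
    calc dimH (NonautonomousIFS.limitSet X (φ t)) ≤ dimH (univ : Set (Euc m)) :=
          dimH_mono (subset_univ _)
      _ = m := by rw [Real.dimH_univ_eq_finrank, finrank_euclideanSpace_fin]
  · obtain ⟨k, hk⟩ : ∃ k, IsEmpty (I k) := by simpa using hI
    have hb : ∀ t, NonautonomousIFS.bowenDim X (φ t) = 0 := fun t =>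
      NonautonomousIFS.bowenDim_eq_zero_of_isEmpty X (φ t) hk
    have hΩ : IsEmpty (NonautonomousIFS.InfWord I 0) :=
      ⟨fun ω => hk.false (ω ⟨k, Nat.zero_le k⟩)⟩
    refine ⟨Eventually.of_forall fun t _ => ?_, Eventually.of_forall fun t _ hlt => ?_⟩
    · rw [hb, NonautonomousIFS.limitSet, range_eq_empty, dimH_empty, min_eq_right zero_le]
    · rw [hb] at hlt
      exact absurd hlt not_lt_zero
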